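/- **Setting.** Let $n<p$ and let $X\in\mathbb R^{n\times p}$ have i.i.d. rows distributed as a source vector $x\in\mathbb R^p$. In a fixed orthonormal basis diagonalizing both covariance matrices, $\mathbb E[x]=0$ and $\mathbb E[xx^\top]=\Sigma_s=\mathrm{diag}(\lambda_1,\dots,\lambda_p)$ with $\lambda_1\ge\dots\ge\lambda_p>0$. The target covariance is $\Sigma_t=\mathrm{diag}(\tilde\lambda_1,\dots,\tilde\lambda_p)$ with all $\tilde\lambda_i\ge 0$. The whitened vector $z=\Sigma_s^{-1/2}x$ has independent coordinates and is subgaussian with parameter $\sigma_x>0$: $\mathbb E[e^{\gamma^\top z}]\le e^{\sigma_x^2\|\gamma\|^2/2}$ for all $\gamma\in\mathbb R^p$. For $\theta\in\mathbb R^p$, the bias is $$B(\theta)=\big(\theta-\hat\theta\big)^\top\Sigma_t\big(\theta-\hat\theta\big),\qquad \hat\theta=X^\top(XX^\top)^{-1}X\theta ,$$ where $\hat\theta$ is the minimum-norm interpolator of the labels $X\theta$. For $0\le k<p$ put $$\rho_k=\frac{\sum_{i>k}\lambda_i}{n\,\lambda_{k+1}} .$$ **Theorem.** There is a universal constant $b>1$,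 and for every $\sigma_x>0$ there are constants $c,C>1$ depending only on $b$ and $\sigma_x$, such that the following holds in the above setting, for all $n,p$, all source laws and $\tilde\lambda$ as above, all $\theta\in\mathbb R^p$, and all $k$ with $0\le k<n/C$ and $\rho_k\ge b$. 1. (Lower bound.) Let $\bar\theta_i=\gamma_i\theta_i$ with $\gamma_1,\dots,\gamma_p$ independent Rademacher signs, independent of $X$. With probability at least $1-10e^{-n/c}$ over $X$, the matrix $XX^\top$ is invertible and $$\mathbb E_{\bar\theta}\big[B(\bar\theta)\big]\;\ge\;\frac1c\left(\sum_{i\le k}\frac{\tilde\lambda_i\theta_i^2}{\big(1+\frac{\lambda_i}{\lambda_{k+1}\rho_k}\big)^2}+\sum_{i>k}\tilde\lambda_i\theta_i^2\right).$$ 2. (Upper bound.) If $p$ is at most exponential in $n$, that is, $p\le e^{an}$ for some $a>0$ (the constants $c,C$ do not depend on $a$), then with probability at least $1-5e^{-n/c}$ over $X$, the matrix $XX^\top$ is invertible and $$B(\theta)\;\le\; c\,\|\theta\|^2\sum_{i=1}^p\frac{\tilde\lambda_i}{1+\frac{\lambda_i}{\lambda_{k+1}\rho_k}} .$$ -/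

import Mathlib

open MeasureTheory ProbabilityTheory
open scoped BigOperators Matrix

noncomputable section

/-- The law `D` of one source covariate vector `x ∈ ℝᵖ`, in the basis that diagonalizes both
covariance matrices: `E[x] = 0`, `E[x xᵀ] = diag(lam)` with `lam` positive and non-increasing, and
the whitened vector `z = diag(lam)^(-1/2) x` has independent coordinates and satisfies
`E[exp(⟨γ, z⟩)] ≤ exp(σ² ‖γ‖² / 2)` for all `γ` (the expectation being finite). -/
structure IsSourceLaw {p : ℕ} (D : Measure (Fin p → ℝ)) (lam : Fin p → ℝ) (σ : ℝ) : Prop where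
  isProbabilityMeasure : IsProbabilityMeasure D
  pos : ∀ i, 0 < lam i
  antitone : Antitone lam
  centered : ∀ i, ∫ x, x i ∂D = 0
  covariance : ∀ i j, ∫ x, x i * x j ∂D = Matrix.diagonal lam i j
  indep : iIndepFun (fun (i : Fin p) (x : Fin p → ℝ) => x i / √(lam i)) D
  subgaussian : ∀ γ : Fin p → ℝ,
    Integrable (fun x : Fin p → ℝ => Real.exp (∑ i, γ i * (x i / √(lam i)))) D ∧
      ∫ x, Real.exp (∑ i, γ i * (x i / √(lam i))) ∂D ≤ Real.exp (σ ^ 2 * (∑ i, γ i ^ 2) / 2)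

/-- The law of the `n × p` data matrix whose rows are `n` i.i.d. samples of `D`. -/
def sampleLaw {p : ℕ} (n : ℕ) (D : Measure (Fin p → ℝ)) : Measure (Fin n → Fin p → ℝ) :=
  Measure.pi (fun _ => D)

/-- `ρ_k = (∑_{i > k} lam_i) / (n lam_{k+1})` in one-based indexing. Here indices start from zero:
the entry `lam k` is the `(k+1)`-st eigenvalue, and the indices `i` with `k ≤ i` are the tail. -/
def effRatio {p : ℕ} (n : ℕ) (lam : Fin p → ℝ) (k : Fin p) : ℝ :=
  (∑ i ∈ Finset.Ici k, lam i) / (n * lam k)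

/-- The minimum-norm interpolator `Xᵀ (X Xᵀ)⁻¹ ξ`. -/
def minNormInterpolator {n p : ℕ} (X : Matrix (Fin n) (Fin p) ℝ) (ξ : Fin n → ℝ) : Fin p → ℝ :=
  Xᵀ *ᵥ ((X * Xᵀ)⁻¹ *ᵥ ξ)

/-- If `X Xᵀ` is invertible, `minNormInterpolator X ξ` is the unique vector of least Euclidean norm
among the solutions of `X θ = ξ`. -/
theorem minNormInterpolator_spec {n p : ℕ} (X : Matrix (Fin n) (Fin p) ℝ) (ξ : Fin n → ℝ)
    (hX : IsUnit (X * Xᵀ).det) :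
    X *ᵥ minNormInterpolator X ξ = ξ ∧
      ∀ θ : Fin p → ℝ, X *ᵥ θ = ξ → θ ≠ minNormInterpolator X ξ →
        ∑ i, minNormInterpolator X ξ i ^ 2 < ∑ i, θ i ^ 2 := by
  have h1 : X *ᵥ minNormInterpolator X ξ = ξ := by
    simp [minNormInterpolator, Matrix.mulVec_mulVec, ← Matrix.mul_assoc,
      Matrix.mul_nonsing_inv _ hX]
  refine ⟨h1, fun θ hθ hne => ?_⟩
  set m := minNormInterpolator X ξ with hm
  have h2 : m ⬝ᵥ (θ - m) = 0 := by
    rw [hm, minNormInterpolator, Matrix.mulVec_transpose, ← Matrix.dotProduct_mulVec,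
      ← Matrix.mulVec_transpose]
    change _ ⬝ᵥ (X *ᵥ (θ - m)) = 0
    rw [Matrix.mulVec_sub, hθ, h1, sub_self, dotProduct_zero]
  obtain ⟨j, hj⟩ := Function.ne_iff.1 hne
  have h3 : 0 < ∑ i, (θ i - m i) ^ 2 :=
    Finset.sum_pos' (fun i _ => sq_nonneg _)
      ⟨j, Finset.mem_univ _, by have := sub_ne_zero.2 hj; positivity⟩
  have h4 : ∑ i, θ i ^ 2 = ∑ i, m i ^ 2 + 2 * (m ⬝ᵥ (θ - m)) + ∑ i, (θ i - m i) ^ 2 := by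
    simp only [dotProduct, Finset.mul_sum, ← Finset.sum_add_distrib, Pi.sub_apply]
    exact Finset.sum_congr rfl fun i _ => by ring
  rw [h4, h2]
  linarith

/-- The bias `‖θ - MNI(X θ)‖²` in the seminorm `‖v‖² = vᵀ diag(lamT) v` of the target covariance
matrix `diag(lamT)`. -/
def bias {n p : ℕ} (lamT : Fin p → ℝ) (X : Matrix (Fin n) (Fin p) ℝ) (θ : Fin p → ℝ) : ℝ :=
  (θ - minNormInterpolator X (X *ᵥ θ)) ⬝ᵥ
    (Matrix.diagonal lamT *ᵥ (θ - minNormInterpolator X (X *ᵥ θ)))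

/-- The expectation, over independent uniform signs `γ_i ∈ {1, -1}`, of the bias for the model
vector `(γ_i θ_i)_i`; independent Rademacher signs are uniform on `{1, -1}ᵖ`. -/
def expectedBias {n p : ℕ} (lamT : Fin p → ℝ) (X : Matrix (Fin n) (Fin p) ℝ) (θ : Fin p → ℝ) : ℝ :=
  (∑ γ : Fin p → ℤˣ, bias lamT X (fun i => ((γ i : ℤ) : ℝ) * θ i)) / 2 ^ p

end

/-! ### Moments, Laplace transform and characteristic function of one variable -/

/-! When XXᵀ is invertible, θ − θ̂ = Pθ with P the orthogonal projection onto ker X, so B(θ) = ∑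
λ̃_i (Pθ)_i². Row i of P has squared norm P_ii. Cauchy–Schwarz gives (Pθ)_i² ≤ P_ii ‖θ‖², and
averaging over signs gives E (Pθ̄)_j² ≥ P_jj² θ_j² (`bias_le`, `le_expectedBias`). Everything
reduces to two-sided bounds on P_jj, the squared distance from e_j to the row space, that is, the
minimum of ‖e_j − Xᵀa‖² over a.

Let S = ∑_{i>k} λ_i = n λ_{k+1} ρ_k. If column j has squared norm at most A and the tail columns
other than j satisfy a lower frame bound B, then P_jj ≥ 1/(1 + A/B) (`le_nullProj_diag`); here A is
of order nλ_j and B of order S. Conversely, for j in the head one can choose a with Xᵀa = e_j on all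
head coordinates and ‖a‖² of order 1/(nλ_j); the error then sits in the tail and is of order S‖a‖²
(`nullProj_diag_le_of_head`). For j in the tail, P_jj ≤ 1 suffices.

The frame bounds come from nets for arrays of independent subgaussian entries. The tail columns
carry weights λ_i/λ_{k+1} in [0,1], and Jensen's inequality for Laplace transforms makes them behave
like S/λ_{k+1} columns of weight one. The upper tail bound and the lower head bound (many more
samples than head coordinates) follow from Chernoff bounds on a net. The lower tail bound is the
delicate one: b must not depend on σ_x, so only an aspect ratio of 2 is available. The sphere is
split (`exists_wide_lower_bound`). Vectors with few coordinates above ε/√d lie near a net of small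
cardinality. For the others, decay of the characteristic function makes E exp(−q²ξ²) of order 1/q,
and the power 2d of this beats a net of size (Cq)^d.

In the lower bound no union over the p coordinates is affordable. Each coordinate is bad with
exponentially small probability, and Markov's inequality shows that the bad ones carry at most half
of the total weight, again off an exponentially small event (`measureReal_half_weight_le`). -/

theorem integrable_exp_neg_mul_sq_gaussianReal {β : ℝ} (hβ : -(1 / 2) < β) :
    Integrable (fun x => Real.exp (-β * x ^ 2)) (gaussianReal 0 1) := by
  rw [gaussianReal_of_var_ne_zero _ one_ne_zero,
    integrable_withDensity_iff (measurable_gaussianPDF _ _) (by simp [gaussianPDF])]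
  have h := (integrable_exp_neg_mul_sq (b := 1 / 2 + β) (by linarith)).const_mul
    ((√(2 * Real.pi))⁻¹)
  refine h.congr (ae_of_all _ fun x => ?_)
  simp only [gaussianPDF, gaussianPDFReal_def]
  rw [ENNReal.toReal_ofReal (by positivity), mul_left_comm, ← Real.exp_add]
  simp only [NNReal.coe_one, mul_one, sub_zero]
  ring_nf

theorem integral_exp_neg_mul_sq_gaussianReal {β : ℝ} (hβ : -(1 / 2) < β) :
    ∫ x, Real.exp (-β * x ^ 2) ∂(gaussianReal 0 1) = (√(1 + 2 * β))⁻¹ := by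
  rw [integral_gaussianReal_eq_integral_smul one_ne_zero]
  have h : ∀ x : ℝ, gaussianPDFReal 0 1 x • Real.exp (-β * x ^ 2) =
      (√(2 * Real.pi))⁻¹ * Real.exp (-(1 / 2 + β) * x ^ 2) := fun x => by
    rw [gaussianPDFReal_def, smul_eq_mul, mul_assoc, ← Real.exp_add]
    simp only [NNReal.coe_one, mul_one, sub_zero]
    ring_nf
  simp_rw [h]
  rw [integral_const_mul, integral_gaussian, ← Real.sqrt_inv, ← Real.sqrt_inv,
    ← Real.sqrt_mul (by positivity)]
  congr 1
  have : 1 / 2 + β ≠ 0 := by linarith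
  have : 1 + 2 * β ≠ 0 := by linarith
  have := Real.pi_ne_zero
  field_simp

section OneVariable

variable {Ω : Type*} [MeasurableSpace Ω] {μ : Measure Ω} [IsProbabilityMeasure μ]
  {X : Ω → ℝ} {c : NNReal}

theorem integrable_pow (hX : HasSubgaussianMGF X c μ) (k : ℕ) :
    Integrable (fun ω => X ω ^ k) μ := by
  refine ((hX.memLp k).integrable_norm_pow').mono (hX.aestronglyMeasurable.pow k)
    (ae_of_all _ fun ω => ?_)
  simp

theorem integral_one_sub_add (hX : HasSubgaussianMGF X c μ) (a b : ℝ) :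
    Integrable (fun ω => 1 - a * X ω ^ 2 + b * X ω ^ 4) μ ∧
      ∫ ω, (1 - a * X ω ^ 2 + b * X ω ^ 4) ∂μ =
        1 - a * ∫ ω, X ω ^ 2 ∂μ + b * ∫ ω, X ω ^ 4 ∂μ := by
  have h2 : Integrable (fun ω => a * X ω ^ 2) μ := (integrable_pow hX 2).const_mul a
  have h4 : Integrable (fun ω => b * X ω ^ 4) μ := (integrable_pow hX 4).const_mul b
  have h1 : Integrable (fun ω => 1 - a * X ω ^ 2) μ := (integrable_const 1).sub h2
  refine ⟨h1.add h4, ?_⟩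
  rw [integral_add h1 h4, integral_sub (integrable_const 1) h2, integral_const_mul,
    integral_const_mul]
  simp

/-- Gaussian linearization: exp(s²x²/2) is the average of exp(sxg) over a standard Gaussian g. After
exchanging the integrals, the subgaussian bound at s² = 1/(2c) leaves E exp(g²/4) = √2. -/
theorem lintegral_exp_sq_le (hX : HasSubgaussianMGF X c μ) (hc : 0 < c) (hm : Measurable X) :
    ∫⁻ ω, ENNReal.ofReal (Real.exp ((4 * (c : ℝ))⁻¹ * X ω ^ 2)) ∂μ ≤ ENNReal.ofReal 2 := by
  have hc' : (0 : ℝ) < c := by exact_mod_cast hc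
  set s : ℝ := √(2 * (4 * (c : ℝ))⁻¹) with hs
  have hs2 : s ^ 2 = 2 * (4 * (c : ℝ))⁻¹ := Real.sq_sqrt (by positivity)
  have h1 : ∀ ω, ENNReal.ofReal (Real.exp ((4 * (c : ℝ))⁻¹ * X ω ^ 2)) =
      ∫⁻ g, ENNReal.ofReal (Real.exp (s * X ω * g)) ∂(gaussianReal 0 1) := fun ω => by
    rw [← ofReal_integral_eq_lintegral_ofReal (integrable_exp_mul_gaussianReal _)
      (ae_of_all _ fun x => (Real.exp_pos _).le)]
    have := congrFun (mgf_fun_id_gaussianReal (μ := 0) (v := 1)) (s * X ω)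
    rw [mgf] at this
    rw [this]
    congr 2
    rw [mul_pow, hs2]
    simp only [NNReal.coe_one]
    ring
  simp_rw [h1]
  rw [lintegral_lintegral_swap (by fun_prop)]
  have h2 : ∀ g : ℝ, ∫⁻ ω, ENNReal.ofReal (Real.exp (s * X ω * g)) ∂μ ≤
      ENNReal.ofReal (Real.exp (-(-(1 / 4)) * g ^ 2)) := fun g => by
    have h3 : (fun ω => Real.exp (s * X ω * g)) = fun ω => Real.exp (s * g * X ω) := by
      funext ω; ring_nf
    have hi := hX.integrable_exp_mul (s * g)
    rw [← h3] at hi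
    rw [← ofReal_integral_eq_lintegral_ofReal hi (ae_of_all _ fun x => (Real.exp_pos _).le), h3]
    refine ENNReal.ofReal_le_ofReal ((hX.mgf_le (s * g)).trans (le_of_eq ?_))
    congr 1
    rw [mul_pow, hs2]
    field_simp
  refine (lintegral_mono h2).trans ?_
  rw [← ofReal_integral_eq_lintegral_ofReal
    (integrable_exp_neg_mul_sq_gaussianReal (by norm_num))
    (ae_of_all _ fun x => (Real.exp_pos _).le), integral_exp_neg_mul_sq_gaussianReal (by norm_num)]
  refine ENNReal.ofReal_le_ofReal ?_
  rw [inv_le_comm₀ (Real.sqrt_pos.2 (by norm_num)) two_pos]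
  exact Real.le_sqrt_of_sq_le (by norm_num)

theorem integrable_exp_sq (hX : HasSubgaussianMGF X c μ) (hc : 0 < c) (hm : Measurable X) :
    Integrable (fun ω => Real.exp ((4 * (c : ℝ))⁻¹ * X ω ^ 2)) μ := by
  refine ⟨by fun_prop, ?_⟩
  rw [hasFiniteIntegral_iff_ofReal (ae_of_all _ fun x => (Real.exp_pos _).le)]
  exact (lintegral_exp_sq_le hX hc hm).trans_lt ENNReal.ofReal_lt_top

theorem integral_exp_sq_le (hX : HasSubgaussianMGF X c μ) (hc : 0 < c) (hm : Measurable X) :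
    ∫ ω, Real.exp ((4 * (c : ℝ))⁻¹ * X ω ^ 2) ∂μ ≤ 2 := by
  have h := lintegral_exp_sq_le hX hc hm
  rwa [← ofReal_integral_eq_lintegral_ofReal (integrable_exp_sq hX hc hm)
    (ae_of_all _ fun x => (Real.exp_pos _).le), ENNReal.ofReal_le_ofReal_iff two_pos.le] at h

theorem integral_pow_four_le (hX : HasSubgaussianMGF X c μ) (hc : 0 < c) (hm : Measurable X) :
    ∫ ω, X ω ^ 4 ∂μ ≤ 64 * (c : ℝ) ^ 2 := by
  have hc' : (0 : ℝ) < c := by exact_mod_cast hc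
  have h : ∀ ω, X ω ^ 4 ≤ 32 * (c : ℝ) ^ 2 * Real.exp ((4 * (c : ℝ))⁻¹ * X ω ^ 2) := fun ω => by
    have h1 := Real.quadratic_le_exp_of_nonneg (x := (4 * (c : ℝ))⁻¹ * X ω ^ 2) (by positivity)
    have h2 : X ω ^ 4 = 32 * (c : ℝ) ^ 2 * (((4 * (c : ℝ))⁻¹ * X ω ^ 2) ^ 2 / 2) := by
      field_simp; ring
    rw [h2]
    have : 0 ≤ (4 * (c : ℝ))⁻¹ * X ω ^ 2 := by positivity
    gcongr
    linarith
  have h4 : Integrable (fun ω => X ω ^ 4) μ := by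
    exact integrable_pow hX 4
  calc ∫ ω, X ω ^ 4 ∂μ
      ≤ ∫ ω, 32 * (c : ℝ) ^ 2 * Real.exp ((4 * (c : ℝ))⁻¹ * X ω ^ 2) ∂μ :=
        integral_mono h4 ((integrable_exp_sq hX hc hm).const_mul _) h
    _ ≤ 32 * (c : ℝ) ^ 2 * 2 := by
        rw [integral_const_mul]
        gcongr
        exact integral_exp_sq_le hX hc hm
    _ = _ := by ring

theorem integrable_exp_neg_sq (hm : Measurable X) {t : ℝ} (ht : 0 ≤ t) :
    Integrable (fun ω => Real.exp (-t * X ω ^ 2)) μ := by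
  refine Integrable.of_bound (C := 1) (by fun_prop) (ae_of_all _ fun ω => ?_)
  rw [Real.norm_eq_abs, Real.abs_exp, Real.exp_le_one_iff]
  nlinarith [sq_nonneg (X ω)]

theorem integral_exp_neg_sq_le (hX : HasSubgaussianMGF X c μ) (hm : Measurable X)
    {τ M t : ℝ} (h2 : ∫ ω, X ω ^ 2 ∂μ = τ) (h4 : ∫ ω, X ω ^ 4 ∂μ ≤ M) (ht : 0 ≤ t) :
    ∫ ω, Real.exp (-t * X ω ^ 2) ∂μ ≤ Real.exp (-t * τ + t ^ 2 * M / 2) := by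
  have i4 : Integrable (fun ω => X ω ^ 4) μ := by
    exact integrable_pow hX 4
  have i2 : Integrable (fun ω => X ω ^ 2) μ := by
    exact integrable_pow hX 2
  have hp : ∀ ω, Real.exp (-t * X ω ^ 2) ≤ 1 - t * X ω ^ 2 + t ^ 2 / 2 * X ω ^ 4 := fun ω => by
    have hy : 0 ≤ t * X ω ^ 2 := by positivity
    have h1 := Real.quadratic_le_exp_of_nonneg hy
    have h3 : Real.exp (-t * X ω ^ 2) * Real.exp (t * X ω ^ 2) = 1 := by
      rw [← Real.exp_add]; simp
    set y := t * X ω ^ 2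
    have h5 : t ^ 2 / 2 * X ω ^ 4 = y ^ 2 / 2 := by simp only [y]; ring
    rw [h5]
    have hq : 0 < 1 - y + y ^ 2 / 2 := by nlinarith [sq_nonneg (y - 1)]
    -- The product is 1 + y⁴/4, so the lower bound 1 + y + y²/2 ≤ e^y turns into e^(−y) ≤ 1 − y +
    -- y²/2.
    have h6 : 1 ≤ (1 - y + y ^ 2 / 2) * (1 + y + y ^ 2 / 2) := by
      nlinarith [sq_nonneg (y ^ 2)]
    have h7 := mul_le_mul_of_nonneg_left h1 hq.le
    have h8 := Real.exp_pos (-t * X ω ^ 2)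
    by_contra hcon
    push Not at hcon
    have := mul_lt_mul_of_pos_right hcon (Real.exp_pos y)
    linarith
  calc ∫ ω, Real.exp (-t * X ω ^ 2) ∂μ
      ≤ ∫ ω, (1 - t * X ω ^ 2 + t ^ 2 / 2 * X ω ^ 4) ∂μ :=
        integral_mono (integrable_exp_neg_sq hm ht)
          (integral_one_sub_add hX _ _).1 hp
    _ = 1 - t * τ + t ^ 2 / 2 * ∫ ω, X ω ^ 4 ∂μ := by
        rw [(integral_one_sub_add hX _ _).2, h2]
    _ ≤ 1 - t * τ + t ^ 2 / 2 * M := by gcongr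
    _ ≤ _ := by
        have := Real.add_one_le_exp (-t * τ + t ^ 2 * M / 2)
        linarith

/-- Jensen's inequality for a power with exponent in `[0, 1]`. -/
theorem integral_rpow_le_rpow {Y : Ω → ℝ} (hY : ∀ ω, 0 ≤ Y ω) (hi : Integrable Y μ) {A w : ℝ}
    (hA : 0 < A) (hle : ∫ ω, Y ω ∂μ ≤ A) (hw0 : 0 ≤ w) (hw1 : w ≤ 1)
    (hm : AEStronglyMeasurable (fun ω => Y ω ^ w) μ) :
    Integrable (fun ω => Y ω ^ w) μ ∧ ∫ ω, Y ω ^ w ∂μ ≤ A ^ w := by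
  -- Bernoulli's inequality: the concave power lies below its tangent at `A`. Using `A` in place of
  -- the mean gives the bound by `A ^ w` directly.
  have hb : ∀ ω, Y ω ^ w ≤ A ^ w * (1 + w * (Y ω / A - 1)) := fun ω => by
    have h := rpow_one_add_le_one_add_mul_self (s := Y ω / A - 1)
      (by have := div_nonneg (hY ω) hA.le; linarith) hw0 hw1
    rw [add_sub_cancel, Real.div_rpow (hY ω) hA.le,
      div_le_iff₀' (Real.rpow_pos_of_pos hA w)] at h
    exact h
  have hi0 : Integrable (fun ω => Y ω / A - 1) μ := (hi.div_const _).sub (integrable_const _)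
  have hi' : Integrable (fun ω => A ^ w * (1 + w * (Y ω / A - 1))) μ :=
    ((integrable_const _).add (hi0.const_mul _)).const_mul _
  have hI : Integrable (fun ω => Y ω ^ w) μ := hi'.mono' hm (ae_of_all _ fun ω => by
    rw [Real.norm_eq_abs, abs_of_nonneg (Real.rpow_nonneg (hY ω) w)]
    exact hb ω)
  refine ⟨hI, (integral_mono hI hi' hb).trans ?_⟩
  rw [integral_const_mul, integral_add (integrable_const _)
    (hi0.const_mul _), integral_const_mul,
    integral_sub (hi.div_const _) (integrable_const _), integral_div]
  simp only [integral_const, probReal_univ, smul_eq_mul, mul_one]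
  have : (∫ ω, Y ω ∂μ) / A ≤ 1 := (div_le_one hA).2 hle
  have h0 := Real.rpow_pos_of_pos hA w
  nlinarith [mul_nonneg hw0 (sub_nonneg.2 this)]

/-! ### Characteristic functions near the origin and the Laplace transform of a square -/

theorem one_sub_cos_ge (x : ℝ) : Real.cos x ≤ 1 - x ^ 2 / 2 + x ^ 4 / 24 := by
  have h1 : Real.cos x = 1 - 2 * Real.sin (x / 2) ^ 2 := by
    have := Real.cos_sq' (x / 2)
    have h := Real.cos_two_mul (x / 2)
    rw [mul_div_cancel₀ _ two_ne_zero] at h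
    linarith
  have h2 : ∀ y : ℝ, 0 ≤ y → y ^ 2 - y ^ 4 / 3 ≤ Real.sin y ^ 2 := fun y hy => by
    have h := Real.sin_ge_sub_cube hy
    by_cases h3 : y ^ 2 ≤ 3
    · have h4 : 0 ≤ y - y ^ 3 / 6 := by nlinarith
      have h5 := pow_le_pow_left₀ h4 h 2
      nlinarith [sq_nonneg (y ^ 3)]
    · nlinarith [sq_nonneg (Real.sin y), sq_nonneg y]
  have h3 := h2 |x / 2| (abs_nonneg _)
  have h4 : Real.sin |x / 2| ^ 2 = Real.sin (x / 2) ^ 2 := by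
    rcases abs_choice (x / 2) with h | h <;> rw [h]
    rw [Real.sin_neg, neg_sq]
  rw [h4, sq_abs, ← Even.pow_abs (n := 4) (by decide), abs_abs, Even.pow_abs (by decide)] at h3
  rw [h1]
  nlinarith

theorem abs_sin_sub_le (x : ℝ) : |Real.sin x - x| ≤ |x| ^ 3 / 6 := by
  have h : ∀ y : ℝ, 0 ≤ y → |Real.sin y - y| ≤ y ^ 3 / 6 := fun y hy => by
    have h1 := Real.sin_ge_sub_cube hy
    have h2 := Real.sin_le hy
    rw [abs_le]
    constructor
    · linarith
    · have : 0 ≤ y ^ 3 := by positivity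
      linarith
  rcases le_total 0 x with hx | hx
  · rw [abs_of_nonneg hx]; exact h x hx
  · have := h (-x) (by linarith)
    rw [abs_of_nonpos hx]
    rwa [Real.sin_neg, ← neg_add', abs_neg, ← sub_eq_add_neg] at this

/-- Taylor expansion: the real part is 1 − s²/2 + O(Ms⁴), and the mean being zero makes the
imaginary part O((1 + M)|s|³). For s²(1 + M) ≤ 1 the squared modulus is at most 1 − s²/4, hence at
most exp(−s²/4). -/
theorem norm_charFun_le_exp (hX : HasSubgaussianMGF X c μ) (hm : Measurable X)
    (h1 : ∫ ω, X ω ∂μ = 0) (h2 : ∫ ω, X ω ^ 2 ∂μ = 1) {M : ℝ} (h4 : ∫ ω, X ω ^ 4 ∂μ ≤ M)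
    {s : ℝ} (hs : s ^ 2 * (1 + M) ≤ 1) :
    ‖charFun (μ.map X) s‖ ≤ Real.exp (-s ^ 2 / 8) := by
  have i1 : Integrable X μ := hX.integrable
  have i4 : Integrable (fun ω => X ω ^ 4) μ := by
    exact integrable_pow hX 4
  have i2 : Integrable (fun ω => X ω ^ 2) μ := by
    exact integrable_pow hX 2
  have hM : 0 ≤ M := (integral_nonneg fun ω => by positivity).trans h4
  have hs0 : 0 ≤ s ^ 2 := sq_nonneg s
  have hs1 : s ^ 2 ≤ 1 := by nlinarith
  have hcos : Integrable (fun ω => Real.cos (s * X ω)) μ :=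
    Integrable.of_bound (C := 1) (by fun_prop) (ae_of_all _ fun ω => Real.abs_cos_le_one _)
  have hsin : Integrable (fun ω => Real.sin (s * X ω)) μ :=
    Integrable.of_bound (C := 1) (by fun_prop) (ae_of_all _ fun ω => Real.abs_sin_le_one _)
  have hcf : charFun (μ.map X) s =
      ((∫ ω, Real.cos (s * X ω) ∂μ : ℝ) : ℂ) + ((∫ ω, Real.sin (s * X ω) ∂μ : ℝ) : ℂ) * Complex.I := by
    rw [charFun_apply_real, integral_map hm.aemeasurable (by fun_prop), ← integral_complex_ofReal,
      ← integral_complex_ofReal, ← integral_mul_const, ← integral_add hcos.ofReal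
        (hsin.ofReal.mul_const _)]
    refine integral_congr_ae (ae_of_all _ fun ω => ?_)
    simp only
    rw [← Complex.ofReal_mul, Complex.exp_mul_I]
    push_cast
    rfl
  set a := ∫ ω, Real.cos (s * X ω) ∂μ with ha
  set b := ∫ ω, Real.sin (s * X ω) ∂μ with hb
  have hau : a ≤ 1 - s ^ 2 / 2 + s ^ 4 / 24 * M := by
    have h : ∀ ω, Real.cos (s * X ω) ≤ 1 - s ^ 2 / 2 * X ω ^ 2 + s ^ 4 / 24 * X ω ^ 4 :=
      fun ω => (one_sub_cos_ge _).trans (le_of_eq (by ring))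
    have := integral_mono hcos (integral_one_sub_add hX _ _).1 h
    rw [(integral_one_sub_add hX _ _).2, h2] at this
    have h6 : s ^ 4 / 24 * ∫ ω, X ω ^ 4 ∂μ ≤ s ^ 4 / 24 * M := by gcongr
    linarith
  -- This makes the real part nonnegative, so that a ≤ 1 yields a² ≤ a.
  have hal : 1 - s ^ 2 / 2 ≤ a := by
    have h : ∀ ω, 1 - s ^ 2 / 2 * X ω ^ 2 + 0 * X ω ^ 4 ≤ Real.cos (s * X ω) :=
      fun ω => (le_of_eq (by ring)).trans Real.one_sub_sq_div_two_le_cos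
    have := integral_mono (integral_one_sub_add hX _ _).1 hcos h
    rw [(integral_one_sub_add hX _ _).2, h2] at this
    linarith
  have hbu : |b| ≤ |s| ^ 3 * (1 + M) / 12 := by
    have h0 : b = ∫ ω, (Real.sin (s * X ω) - s * X ω) ∂μ := by
      rw [integral_sub hsin (i1.const_mul s), integral_const_mul, h1]; simp [hb]
    rw [h0]
    have h : ∀ ω, |Real.sin (s * X ω) - s * X ω| ≤ |s| ^ 3 / 12 * (X ω ^ 2 + X ω ^ 4) := fun ω => by
      refine (abs_sin_sub_le _).trans ?_
      rw [abs_mul, mul_pow]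
      have : |X ω| ^ 3 ≤ (X ω ^ 2 + X ω ^ 4) / 2 := by
        rw [← sq_abs, ← Even.pow_abs (n := 4) (by decide)]
        nlinarith [mul_nonneg (sq_nonneg |X ω|) (sq_nonneg (|X ω| - 1))]
      have h3 : 0 ≤ |s| ^ 3 := by positivity
      nlinarith
    refine (abs_integral_le_integral_abs).trans ((integral_mono (hsin.sub (i1.const_mul s)).abs
      ((i2.add i4).const_mul _) h).trans ?_)
    rw [integral_const_mul]
    have := integral_add i2 i4
    simp only [Pi.add_apply] at this ⊢
    rw [this, h2]
    have h3 : 0 ≤ |s| ^ 3 := by positivity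
    nlinarith
  have ha1 : a ≤ 1 := by
    have := integral_mono hcos (integrable_const (1 : ℝ)) fun ω => Real.cos_le_one _
    simpa using this
  have hsq : ‖charFun (μ.map X) s‖ ^ 2 = a ^ 2 + b ^ 2 := by
    rw [hcf, Complex.sq_norm, Complex.normSq_add_mul_I]
  have hb2 : b ^ 2 ≤ s ^ 2 / 144 := by
    have h5 : b ^ 2 ≤ (|s| ^ 3 * (1 + M) / 12) ^ 2 := by
      rw [← sq_abs]; exact pow_le_pow_left₀ (abs_nonneg _) hbu 2
    have h6 : (|s| ^ 3 * (1 + M) / 12) ^ 2 = s ^ 2 * (s ^ 2 * (1 + M)) ^ 2 / 144 := by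
      rw [div_pow, mul_pow, ← pow_mul, show 3 * 2 = 2 * 3 by norm_num, pow_mul, sq_abs]; ring
    rw [h6] at h5
    have h7 : (s ^ 2 * (1 + M)) ^ 2 ≤ 1 := pow_le_one₀ (by positivity) hs
    nlinarith
  have ha2 : a ^ 2 ≤ 1 - s ^ 2 / 2 + s ^ 2 / 24 := by
    have : a ^ 2 ≤ a := by nlinarith
    have h8 : s ^ 4 * M ≤ s ^ 2 := by nlinarith
    linarith
  have hfin : ‖charFun (μ.map X) s‖ ^ 2 ≤ Real.exp (-s ^ 2 / 8) ^ 2 := by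
    rw [hsq, ← Real.exp_nat_mul]
    have := Real.add_one_le_exp (((2 : ℕ) : ℝ) * (-s ^ 2 / 8))
    push_cast at this ⊢
    linarith
  exact le_of_sq_le_sq hfin (Real.exp_pos _).le

/-- exp(−tx²) is the Gaussian average of exp(i√(2t)gx); Fubini's theorem then produces the
characteristic function of X. -/
theorem integral_exp_neg_sq_le_charFun (hm : Measurable X) {t : ℝ} (ht : 0 ≤ t) :
    ∫ ω, Real.exp (-t * X ω ^ 2) ∂μ ≤
      ∫ g, ‖charFun (μ.map X) (√(2 * t) * g)‖ ∂(gaussianReal 0 1) := by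
  set s := √(2 * t)
  have hs : s ^ 2 = 2 * t := Real.sq_sqrt (by positivity)
  have h1 : ∀ ω, ((Real.exp (-t * X ω ^ 2) : ℝ) : ℂ) =
      ∫ g : ℝ, Complex.exp ((g * (s * X ω) : ℝ) * Complex.I) ∂(gaussianReal 0 1) := fun ω => by
    have := charFun_gaussianReal (μ := 0) (v := 1) (s * X ω)
    rw [charFun_apply_real] at this
    have h2 : ∀ g : ℝ, Complex.exp ((g * (s * X ω) : ℝ) * Complex.I) =
      Complex.exp (((s * X ω : ℝ) : ℂ) * g * Complex.I) := fun g => by push_cast; ring_nf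
    simp_rw [h2]
    rw [this]
    push_cast
    congr 1
    have : (s : ℂ) ^ 2 = 2 * t := by exact_mod_cast congrArg (fun x : ℝ => (x : ℂ)) hs
    rw [mul_pow, this]
    ring
  have hint : Integrable (Function.uncurry fun (ω : Ω) (g : ℝ) =>
      Complex.exp ((g * (s * X ω) : ℝ) * Complex.I)) (μ.prod (gaussianReal 0 1)) := by
    refine Integrable.of_bound (C := 1) ?_ (ae_of_all _ fun p => ?_)
    · refine Measurable.aestronglyMeasurable ?_
      simp only [Function.uncurry_def]
      fun_prop
    · simp only [Function.uncurry_def]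
      rw [Complex.norm_exp_ofReal_mul_I]
  have h3 : ((∫ ω, Real.exp (-t * X ω ^ 2) ∂μ : ℝ) : ℂ) =
      ∫ g : ℝ, charFun (μ.map X) (s * g) ∂(gaussianReal 0 1) := by
    rw [← integral_complex_ofReal]
    simp_rw [h1]
    rw [integral_integral_swap hint]
    refine integral_congr_ae (ae_of_all _ fun g => ?_)
    simp only
    rw [charFun_apply_real, integral_map hm.aemeasurable (by fun_prop)]
    refine integral_congr_ae (ae_of_all _ fun ω => ?_)
    simp only
    push_cast
    ring_nf
  have h4 := norm_integral_le_integral_norm (μ := gaussianReal 0 1)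
    (fun g : ℝ => charFun (μ.map X) (s * g))
  rw [← h3, Complex.norm_real] at h4
  exact (le_abs_self _).trans h4

/-- Where |√(2t)g| ≤ R the assumed decay gives a Gaussian integral. Elsewhere the characteristic
function is at most 1, and 1 ≤ 2tg²/R² there, as in Chebyshev's inequality. -/
theorem integral_exp_neg_sq_le_of_charFun_decay (hm : Measurable X) {t κ R : ℝ} (ht : 0 ≤ t)
    (hκ : 0 ≤ κ) (hR : 0 < R)
    (h : ∀ s, |s| ≤ R → ‖charFun (μ.map X) s‖ ≤ Real.exp (-κ * s ^ 2)) :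
    ∫ ω, Real.exp (-t * X ω ^ 2) ∂μ ≤ (√(1 + 4 * κ * t))⁻¹ + 2 * t / R ^ 2 := by
  have := Measure.isProbabilityMeasure_map (μ := μ) hm.aemeasurable
  set s := √(2 * t)
  have hs : s ^ 2 = 2 * t := Real.sq_sqrt (by positivity)
  have hb : ∀ g : ℝ, ‖charFun (μ.map X) (s * g)‖ ≤
      Real.exp (-(2 * κ * t) * g ^ 2) + 2 * t / R ^ 2 * g ^ 2 := fun g => by
    by_cases hg : |s * g| ≤ R
    · refine (h _ hg).trans ?_
      rw [mul_pow, hs]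
      have : 0 ≤ 2 * t / R ^ 2 * g ^ 2 := by positivity
      rw [show -κ * (2 * t * g ^ 2) = -(2 * κ * t) * g ^ 2 by ring]
      linarith
    · refine (norm_charFun_le_one _).trans ?_
      have h1 : R ^ 2 ≤ (s * g) ^ 2 := by
        rw [← sq_abs (s * g)]; exact pow_le_pow_left₀ hR.le (not_le.1 hg).le 2
      rw [mul_pow, hs] at h1
      have h2 : 1 ≤ 2 * t / R ^ 2 * g ^ 2 := by
        rw [div_mul_eq_mul_div, le_div_iff₀ (by positivity)]; linarith
      have := Real.exp_pos (-(2 * κ * t) * g ^ 2)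
      linarith
  have h0 : -(1 / 2) < 2 * κ * t := by have : 0 ≤ 2 * κ * t := by positivity
                                       linarith
  have hg2 : Integrable (fun g : ℝ => g ^ 2) (gaussianReal 0 1) := by
    simpa using (memLp_id_gaussianReal (μ := 0) (v := 1) 2).integrable_norm_pow (by norm_num)
  have hv : ∫ g : ℝ, g ^ 2 ∂(gaussianReal 0 1) = 1 := by
    have := variance_fun_id_gaussianReal (μ := 0) (v := 1)
    rw [variance_eq_integral (by fun_prop), integral_id_gaussianReal] at this
    simpa using this
  have hi1 := integrable_exp_neg_mul_sq_gaussianReal h0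
  refine (integral_exp_neg_sq_le_charFun hm ht).trans ((integral_mono_of_nonneg
    (ae_of_all _ fun _ => norm_nonneg _) (hi1.add (hg2.const_mul _)) (ae_of_all _ hb)).trans ?_)
  have := integral_add hi1 (hg2.const_mul (2 * t / R ^ 2))
  simp only [Pi.add_apply] at this ⊢
  rw [this, integral_const_mul, hv,
    integral_exp_neg_mul_sq_gaussianReal h0, mul_one]
  ring_nf
  exact le_rfl

end OneVariable

/-! ### Lattice nets of the Euclidean ball -/

/-- Rounding of a real number to an integer, towards zero. -/
noncomputable def roundToZero (x : ℝ) : ℤ := if 0 ≤ x then ⌊x⌋ else ⌈x⌉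

theorem abs_roundToZero_le (x : ℝ) : |(roundToZero x : ℝ)| ≤ |x| := by
  unfold roundToZero
  split_ifs with h
  · rw [abs_of_nonneg h, abs_of_nonneg (by exact_mod_cast Int.floor_nonneg.2 h)]
    exact Int.floor_le x
  · have hc : (⌈x⌉ : ℝ) ≤ 0 := by exact_mod_cast Int.ceil_le.2 (by simpa using (not_le.1 h).le)
    rw [abs_of_nonpos hc, abs_of_neg (not_le.1 h)]
    linarith [Int.le_ceil x]

theorem abs_sub_roundToZero_le (x : ℝ) : |x - roundToZero x| ≤ 1 := by
  unfold roundToZero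
  rw [abs_le]
  split_ifs with h
  · constructor <;> linarith [Int.floor_le x, Int.lt_floor_add_one x]
  · constructor <;> linarith [Int.le_ceil x, Int.ceil_lt_add_one x]

theorem one_le_abs_of_roundToZero_ne {x : ℝ} (h : roundToZero x ≠ 0) : 1 ≤ |x| := by
  refine le_trans ?_ (abs_roundToZero_le x)
  exact_mod_cast Int.one_le_abs h

theorem roundToZero_ne_of_one_le {x : ℝ} (h : 1 ≤ |x|) : roundToZero x ≠ 0 := by
  unfold roundToZero
  split_ifs with h0
  · rw [abs_of_nonneg h0] at h
    have := Int.le_floor.2 (show ((1 : ℤ) : ℝ) ≤ x by simpa using h)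
    omega
  · rw [abs_of_neg (not_le.1 h0)] at h
    have := Int.ceil_le.2 (show x ≤ ((-1 : ℤ) : ℝ) by push_cast; linarith)
    omega

theorem sum_exp_neg_le {β : ℝ} (hβ : 0 < β) (N : ℕ) :
    ∑ k ∈ Finset.range N, Real.exp (-β * (k + 1)) ≤ 1 / β := by
  have h : ∑ k ∈ Finset.range N, Real.exp (-β * (k + 1)) ≤ (1 - Real.exp (-β * N)) / β := by
    induction N with
    | zero => simp
    | succ N ih =>
      rw [Finset.sum_range_succ]
      have h1 : Real.exp (-β * (N + 1)) ≤
          (Real.exp (-β * N) - Real.exp (-β * (N + 1))) / β := by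
        rw [le_div_iff₀ hβ]
        have h2 : Real.exp (-β * N) = Real.exp (-β * (N + 1)) * Real.exp β := by
          rw [← Real.exp_add]; ring_nf
        have h3 := Real.add_one_le_exp β
        have h4 := Real.exp_pos (-β * (N + 1))
        rw [h2]
        nlinarith
      calc _ ≤ (1 - Real.exp (-β * N)) / β +
            (Real.exp (-β * N) - Real.exp (-β * (N + 1))) / β := add_le_add ih h1
        _ = _ := by push_cast; ring
  refine h.trans ?_
  have := Real.exp_pos (-β * N)
  gcongr
  linarith

theorem sum_Icc_neg_abs (g : ℕ → ℝ) (N : ℕ) :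
    ∑ z ∈ Finset.Icc (-(N : ℤ)) N, g z.natAbs = g 0 + 2 * ∑ k ∈ Finset.range N, g (k + 1) := by
  induction N with
  | zero => simp
  | succ N ih =>
    have h : Finset.Icc (-((N + 1 : ℕ) : ℤ)) ((N + 1 : ℕ) : ℤ) =
        insert (-((N + 1 : ℕ) : ℤ)) (insert ((N + 1 : ℕ) : ℤ) (Finset.Icc (-(N : ℤ)) N)) := by
      ext z
      simp only [Finset.mem_Icc, Finset.mem_insert]
      omega
    rw [h, Finset.sum_insert, Finset.sum_insert, ih, Finset.sum_range_succ, Int.natAbs_neg,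
      Int.natAbs_natCast]
    · ring
    · simp
    · simp only [Finset.mem_Icc, Finset.mem_insert]
      omega

section Net

variable {V : Type*} [Fintype V]

/-- The point of the lattice of mesh `ε / √d` with integer coordinates `m`. -/
noncomputable def latticePoint (ε : ℝ) (m : V → ℤ) : EuclideanSpace ℝ V :=
  WithLp.toLp 2 fun v => ε / √(Fintype.card V) * m v

/-- The integer coordinates of the lattice point obtained from `a` by rounding towards zero. -/
noncomputable def latticeRound (ε : ℝ) (a : EuclideanSpace ℝ V) (v : V) : ℤ :=
  roundToZero (a v / (ε / √(Fintype.card V)))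

variable {ε : ℝ}

theorem mesh_pos (hε : 0 < ε) (v : V) : 0 < ε / √(Fintype.card V) := by
  have : 0 < Fintype.card V := Fintype.card_pos_iff.2 ⟨v⟩
  positivity

theorem abs_latticePoint_round_le (hε : 0 < ε) (a : EuclideanSpace ℝ V) (v : V) :
    |latticePoint ε (latticeRound ε a) v| ≤ |a v| := by
  have hh := mesh_pos hε v
  have h := abs_roundToZero_le (a v / (ε / √(Fintype.card V)))
  simp only [latticePoint, latticeRound]
  rw [abs_div, abs_of_pos hh, le_div_iff₀ hh] at h
  rw [abs_mul, abs_of_pos hh, mul_comm]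
  exact h

theorem abs_sub_latticePoint_round_le (hε : 0 < ε) (a : EuclideanSpace ℝ V) (v : V) :
    |a v - latticePoint ε (latticeRound ε a) v| ≤ ε / √(Fintype.card V) := by
  have hh := mesh_pos hε v
  have h := abs_sub_roundToZero_le (a v / (ε / √(Fintype.card V)))
  simp only [latticePoint, latticeRound]
  have h1 : a v - ε / √(Fintype.card V) * roundToZero (a v / (ε / √(Fintype.card V))) =
      ε / √(Fintype.card V) *
        (a v / (ε / √(Fintype.card V)) - roundToZero (a v / (ε / √(Fintype.card V)))) := by
    rw [mul_sub, mul_div_cancel₀ _ hh.ne']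
  rw [h1, abs_mul, abs_of_pos hh]
  exact mul_le_of_le_one_right hh.le h

/-- The reason for rounding towards zero: coordinates below the mesh vanish, so sparsity of the
large coordinates becomes sparsity of the net point, and the norm does not grow. -/
theorem latticeRound_ne_zero_iff (hε : 0 < ε) (a : EuclideanSpace ℝ V) (v : V) :
    latticeRound ε a v ≠ 0 ↔ ε / √(Fintype.card V) ≤ |a v| := by
  have hh := mesh_pos hε v
  have h : ε / √(Fintype.card V) ≤ |a v| ↔ 1 ≤ |a v / (ε / √(Fintype.card V))| := by
    rw [abs_div, abs_of_pos hh, le_div_iff₀ hh, one_mul]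
  rw [h]
  exact ⟨one_le_abs_of_roundToZero_ne, roundToZero_ne_of_one_le⟩

theorem norm_latticePoint_round_le (hε : 0 < ε) (a : EuclideanSpace ℝ V) :
    ‖latticePoint ε (latticeRound ε a)‖ ≤ ‖a‖ := by
  rw [EuclideanSpace.norm_eq, EuclideanSpace.norm_eq]
  refine Real.sqrt_le_sqrt (Finset.sum_le_sum fun v _ => ?_)
  exact pow_le_pow_left₀ (norm_nonneg _) (abs_latticePoint_round_le hε a v) 2

theorem norm_sub_latticePoint_round_le (hε : 0 < ε) (a : EuclideanSpace ℝ V) :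
    ‖a - latticePoint ε (latticeRound ε a)‖ ≤ ε := by
  rw [EuclideanSpace.norm_eq]
  refine Real.sqrt_le_iff.2 ⟨hε.le, ?_⟩
  calc ∑ v, ‖(a - latticePoint ε (latticeRound ε a)) v‖ ^ 2
      ≤ ∑ _v : V, (ε / √(Fintype.card V)) ^ 2 := Finset.sum_le_sum fun v _ =>
        pow_le_pow_left₀ (norm_nonneg _) (abs_sub_latticePoint_round_le hε a v) 2
    _ ≤ ε ^ 2 := by
      rw [Finset.sum_const, Finset.card_univ, nsmul_eq_mul, div_pow, Real.sq_sqrt (by positivity)]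
      rcases Nat.eq_zero_or_pos (Fintype.card V) with h | h
      · rw [h]; simp; positivity
      · have : (Fintype.card V : ℝ) ≠ 0 := by positivity
        rw [mul_div_cancel₀ _ this]

theorem sum_abs_le_sqrt_card_mul_norm (a : EuclideanSpace ℝ V) :
    ∑ v, |a v| ≤ √(Fintype.card V) * ‖a‖ := by
  have h := Finset.sum_mul_sq_le_sq_mul_sq Finset.univ (fun _ : V => (1 : ℝ)) (fun v => |a v|)
  simp only [one_mul, one_pow, Finset.sum_const, Finset.card_univ, nsmul_eq_mul, mul_one,
    sq_abs] at h
  rw [EuclideanSpace.norm_eq, ← Real.sqrt_mul (by positivity)]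
  refine Real.le_sqrt_of_sq_le ?_
  simpa using h

variable [DecidableEq V]

/-- The integer vectors of `ℓ¹` norm at most `R` with at most `s` nonzero entries. -/
noncomputable def latticeBall (V : Type*) [Fintype V] [DecidableEq V] (R s : ℝ) :
    Finset (V → ℤ) :=
  (Fintype.piFinset fun _ : V => Finset.Icc (-(⌊R⌋₊ : ℤ)) ⌊R⌋₊).filter fun m =>
    ∑ v, |(m v : ℝ)| ≤ R ∧ ((Finset.univ.filter fun v => m v ≠ 0).card : ℝ) ≤ s

theorem mem_latticeBall {R s : ℝ} {m : V → ℤ} : m ∈ latticeBall V R s ↔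
    ∑ v, |(m v : ℝ)| ≤ R ∧ ((Finset.univ.filter fun v => m v ≠ 0).card : ℝ) ≤ s := by
  unfold latticeBall
  rw [Finset.mem_filter, and_iff_right_iff_imp]
  rintro ⟨h, -⟩
  rw [Fintype.mem_piFinset]
  intro v
  have h1 : |(m v : ℝ)| ≤ R :=
    (Finset.single_le_sum (f := fun v => |(m v : ℝ)|) (fun _ _ => abs_nonneg _)
      (Finset.mem_univ v)).trans h
  have h2 : (m v).natAbs ≤ ⌊R⌋₊ := by
    apply Nat.le_floor
    rwa [Nat.cast_natAbs, Int.cast_abs]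
  rw [Finset.mem_Icc]
  omega

/-- Counting by exponential weights: each point of the ball has weight exp(βR + γs) ∏ f(m_v) ≥ 1,
where β penalizes the ℓ¹ norm and γ each nonzero entry. The sum of the weights over the whole box
factorizes over coordinates. -/
theorem card_latticeBall_le {R s β γ : ℝ} (hβ : 0 < β) (hγ : 0 ≤ γ) :
    ((latticeBall V R s).card : ℝ) ≤
      Real.exp (β * R + γ * s) * (1 + 2 * Real.exp (-γ) / β) ^ Fintype.card V := by
  set f : ℤ → ℝ := fun z => Real.exp (-β * z.natAbs) * (if z.natAbs = 0 then 1 else Real.exp (-γ))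
    with hf
  have hf0 : ∀ z, 0 ≤ f z := fun z => by
    simp only [hf]; split_ifs <;> positivity
  have h1 : ∀ m ∈ latticeBall V R s, 1 ≤ Real.exp (β * R + γ * s) * ∏ v, f (m v) := fun m hm => by
    obtain ⟨hR, hs⟩ := mem_latticeBall.1 hm
    have h2 : ∏ v, f (m v) = Real.exp (-β * ∑ v, |(m v : ℝ)| -
        γ * (Finset.univ.filter fun v => m v ≠ 0).card) := by
      have h3 : ∀ z, f z = Real.exp (-β * |(z : ℝ)| - γ * (if z ≠ 0 then 1 else 0)) := fun z => by
        simp only [hf, Nat.cast_natAbs, Int.cast_abs, Int.natAbs_eq_zero]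
        by_cases hz : z = 0
        · simp [hz]
        · simp [hz, ← Real.exp_add, sub_eq_add_neg]
      simp_rw [h3]
      rw [← Real.exp_sum, Finset.sum_sub_distrib, ← Finset.mul_sum, ← Finset.mul_sum,
        Finset.sum_boole]
    rw [h2, ← Real.exp_add, Real.one_le_exp_iff]
    nlinarith
  have h4 : ∑ z ∈ Finset.Icc (-(⌊R⌋₊ : ℤ)) ⌊R⌋₊, f z ≤ 1 + 2 * Real.exp (-γ) / β := by
    have := sum_Icc_neg_abs (fun k => Real.exp (-β * k) * (if k = 0 then 1 else Real.exp (-γ))) ⌊R⌋₊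
    simp only [hf]
    rw [this]
    simp only [Nat.cast_zero, mul_zero, Real.exp_zero, if_true, mul_one, Nat.add_eq_zero_iff,
      one_ne_zero, and_false, if_false, ← Finset.sum_mul]
    have h5 := sum_exp_neg_le hβ ⌊R⌋₊
    push_cast
    have h6 := mul_le_mul_of_nonneg_right h5 (Real.exp_pos (-γ)).le
    calc _ ≤ 1 + 2 * (1 / β * Real.exp (-γ)) := by gcongr
      _ = _ := by ring
  calc ((latticeBall V R s).card : ℝ) = ∑ m ∈ latticeBall V R s, 1 := by simp
    _ ≤ ∑ m ∈ latticeBall V R s, Real.exp (β * R + γ * s) * ∏ v, f (m v) := Finset.sum_le_sum h1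
    _ ≤ ∑ m ∈ Fintype.piFinset fun _ : V => Finset.Icc (-(⌊R⌋₊ : ℤ)) ⌊R⌋₊,
        Real.exp (β * R + γ * s) * ∏ v, f (m v) :=
      Finset.sum_le_sum_of_subset_of_nonneg (Finset.filter_subset _ _) fun m _ _ =>
        mul_nonneg (Real.exp_pos _).le (Finset.prod_nonneg fun v _ => hf0 _)
    _ = Real.exp (β * R + γ * s) *
        ∏ _v : V, ∑ z ∈ Finset.Icc (-(⌊R⌋₊ : ℤ)) ⌊R⌋₊, f z := by
      rw [← Finset.mul_sum, Finset.prod_univ_sum]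
    _ ≤ _ := by
      rw [Finset.prod_const, Finset.card_univ]
      gcongr

theorem latticeRound_mem (hε : 0 < ε) {a : EuclideanSpace ℝ V} (ha : ‖a‖ ≤ 1) {s : ℝ}
    (hs : ((Finset.univ.filter fun v => ε / √(Fintype.card V) ≤ |a v|).card : ℝ) ≤ s) :
    latticeRound ε a ∈ latticeBall V (Fintype.card V / ε) s := by
  rw [mem_latticeBall]
  constructor
  · have h1 : ∀ v, |(latticeRound ε a v : ℝ)| ≤ |a v| * (√(Fintype.card V) / ε) := fun v => by
      refine (abs_roundToZero_le _).trans (le_of_eq ?_)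
      rw [abs_div, abs_of_pos (mesh_pos hε v), div_div_eq_mul_div, mul_div_assoc]
    calc ∑ v, |(latticeRound ε a v : ℝ)| ≤ ∑ v, |a v| * (√(Fintype.card V) / ε) :=
          Finset.sum_le_sum fun v _ => h1 v
      _ = (∑ v, |a v|) * (√(Fintype.card V) / ε) := by rw [Finset.sum_mul]
      _ ≤ (√(Fintype.card V) * 1) * (√(Fintype.card V) / ε) := by
          gcongr
          exact (sum_abs_le_sqrt_card_mul_norm a).trans (by gcongr)
      _ = _ := by
          rw [mul_one, ← mul_div_assoc, Real.mul_self_sqrt (by positivity)]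
  · simpa only [latticeRound_ne_zero_iff hε] using hs

theorem card_latticeBall_le' (hε : 0 < ε) (hε1 : ε ≤ 1) (s : ℝ) :
    ((latticeBall V (Fintype.card V / ε) s).card : ℝ) ≤ (9 / ε) ^ Fintype.card V := by
  have hsub : latticeBall V (Fintype.card V / ε) s ⊆
      latticeBall V (Fintype.card V / ε) (Fintype.card V) := fun m hm => by
    rw [mem_latticeBall] at hm ⊢
    exact ⟨hm.1, by exact_mod_cast Finset.card_le_univ _⟩
  have h1 : ((latticeBall V (Fintype.card V / ε) s).card : ℝ) ≤
      (latticeBall V (Fintype.card V / ε) (Fintype.card V)).card := by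
    exact_mod_cast Finset.card_le_card hsub
  -- Take β = ε and γ = 0: the exponential factor is e^d with d the dimension, and e(1 + 2/ε) ≤ 9/ε
  -- because e < 3 and ε ≤ 1.
  refine h1.trans ((card_latticeBall_le hε le_rfl).trans ?_)
  rw [mul_div_cancel₀ _ hε.ne', zero_mul, add_zero, neg_zero, Real.exp_zero, mul_one,
    ← Real.exp_one_rpow, Real.rpow_natCast, ← mul_pow]
  refine pow_le_pow_left₀ (by positivity) ?_ _
  have he := Real.exp_one_lt_d9
  have h2 : 1 ≤ 1 / ε := by rw [le_div_iff₀ hε]; linarith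
  have h3 : Real.exp 1 * (1 + 2 / ε) ≤ 3 * (1 + 2 / ε) := by gcongr; linarith
  have h4 : 2 / ε = 2 * (1 / ε) := by ring
  have h5 : 9 / ε = 9 * (1 / ε) := by ring
  rw [h4] at h3 ⊢
  rw [h5]
  linarith

/-- A linear map that is bounded on the lattice points of mesh `1 / (2 √d)` in the unit ball is
bounded. -/
theorem opNorm_le_of_latticePoint {F : Type*} [NormedAddCommGroup F] [NormedSpace ℝ F]
    (L : EuclideanSpace ℝ V →L[ℝ] F) {A : ℝ} (hA : 0 ≤ A)
    (h : ∀ m ∈ latticeBall V (Fintype.card V / (1 / 2 : ℝ)) (Fintype.card V),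
      ‖latticePoint (1 / 2) m‖ ≤ 1 → ‖L (latticePoint (1 / 2) m)‖ ≤ A) : ‖L‖ ≤ 2 * A := by
  -- Rounding costs at most ‖L‖/2, which is absorbed into the left-hand side at the end.
  have h1 : ∀ a : EuclideanSpace ℝ V, ‖a‖ = 1 → ‖L a‖ ≤ A + 1 / 2 * ‖L‖ := fun a ha => by
    set a' := latticePoint (1 / 2) (latticeRound (1 / 2) a)
    have h2 := h _ (latticeRound_mem (by norm_num) ha.le
      (by exact_mod_cast Finset.card_le_univ _)) ((norm_latticePoint_round_le (by norm_num) a).trans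
        ha.le)
    have h3 := L.le_opNorm (a - a')
    have h4 := norm_sub_latticePoint_round_le (ε := 1 / 2) (by norm_num) a
    have h5 : L a = L a' + L (a - a') := by simp
    rw [h5]
    refine (norm_add_le _ _).trans (add_le_add h2 (h3.trans ?_))
    rw [mul_comm]
    gcongr
  have h6 := L.opNorm_le_of_unit_norm (C := A + 1 / 2 * ‖L‖) (by positivity) h1
  linarith

end Net

/-! ### Arrays of independent subgaussian variables -/

/-- Splitting an independent family indexed by pairs into independent blocks. -/
theorem iIndepFun_curry {Ω ι κ β : Type*} [MeasurableSpace Ω] [MeasurableSpace β] {μ : Measure Ω}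
    {X : ι × κ → Ω → β} (hm : ∀ q, Measurable (X q)) (h : iIndepFun X μ) :
    iIndepFun (fun i ω j => X (i, j) ω) μ := by
  have := h.isProbabilityMeasure
  have hp : ∀ q, IsProbabilityMeasure (μ.map (X q)) := fun q =>
    Measure.isProbabilityMeasure_map (hm q).aemeasurable
  rw [iIndepFun_iff_map_fun_eq_infinitePi_map (by fun_prop)]
  have h1 : ∀ i, μ.map (fun ω j => X (i, j) ω) =
      Measure.infinitePi fun j => μ.map (X (i, j)) := fun i =>
    (h.precomp (g := fun j : κ => (i, j)) fun _ _ hj => by simpa using hj).map_fun_eq_infinitePi_map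
      fun j => hm _
  simp_rw [h1]
  have h2 : (fun ω i j => X (i, j) ω) =
      (MeasurableEquiv.curry ι κ β) ∘ fun ω q => X q ω := by
    funext ω i j; rfl
  rw [h2, ← Measure.map_map (by fun_prop) (by fun_prop), h.map_fun_eq_infinitePi_map hm]
  exact Measure.infinitePi_map_curry fun i j => μ.map (X (i, j))

/-- A family `ζ` of jointly independent variables of unit variance, subgaussian with parameter
`c`. -/
structure IsSubgaussianArray {Ω V T : Type*} [MeasurableSpace Ω] (ζ : V → T → Ω → ℝ) (c : NNReal)
    (μ : Measure Ω) : Prop where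
  measurable : ∀ v t, Measurable (ζ v t)
  indep : iIndepFun (fun q : V × T => ζ q.1 q.2) μ
  integral_eq_zero : ∀ v t, ∫ ω, ζ v t ω ∂μ = 0
  integral_sq : ∀ v t, ∫ ω, ζ v t ω ^ 2 ∂μ = 1
  subgaussian : ∀ v t, HasSubgaussianMGF (ζ v t) c μ

/-- The combination `∑ v, a v * ζ v t` of the entries of column `t`. -/
def colSum {Ω V T : Type*} [Fintype V] (ζ : V → T → Ω → ℝ) (a : EuclideanSpace ℝ V) (t : T)
    (ω : Ω) : ℝ := ∑ v, a v * ζ v t ω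

/-- The weighted sum of squares of the column combinations. -/
def quadForm {Ω V T : Type*} [Fintype V] [Fintype T] (ζ : V → T → Ω → ℝ) (w : T → ℝ)
    (a : EuclideanSpace ℝ V) (ω : Ω) : ℝ := ∑ t, w t * colSum ζ a t ω ^ 2

namespace IsSubgaussianArray

variable {Ω V T : Type*} [MeasurableSpace Ω] {μ : Measure Ω} {ζ : V → T → Ω → ℝ} {c : NNReal}

theorem isProbabilityMeasure (h : IsSubgaussianArray ζ c μ) : IsProbabilityMeasure μ :=
  h.indep.isProbabilityMeasure

theorem swap (h : IsSubgaussianArray ζ c μ) : IsSubgaussianArray (fun t v => ζ v t) c μ where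
  measurable t v := h.measurable v t
  indep := h.indep.precomp (g := Prod.swap) Prod.swap_injective
  integral_eq_zero t v := h.integral_eq_zero v t
  integral_sq t v := h.integral_sq v t
  subgaussian t v := h.subgaussian v t

theorem comp_left {U : Type*} (h : IsSubgaussianArray ζ c μ) {f : U → V}
    (hf : Function.Injective f) : IsSubgaussianArray (fun u => ζ (f u)) c μ where
  measurable _ v := h.measurable _ v
  indep := h.indep.precomp (g := Prod.map f id) (hf.prodMap Function.injective_id)
  integral_eq_zero _ v := h.integral_eq_zero _ v
  integral_sq _ v := h.integral_sq _ v
  subgaussian _ v := h.subgaussian _ v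

theorem indep_column (h : IsSubgaussianArray ζ c μ) (a : EuclideanSpace ℝ V) (t : T) :
    iIndepFun (fun v ω => a v * ζ v t ω) μ :=
  (h.indep.precomp (g := fun v : V => (v, t)) fun _ _ hj => by simpa using hj).comp
    (fun v x => a v * x) fun v => by fun_prop

variable [Fintype V]

theorem measurable_colSum (h : IsSubgaussianArray ζ c μ) (a : EuclideanSpace ℝ V) (t : T) :
    Measurable (colSum ζ a t) := by
  have := h.measurable
  unfold colSum
  fun_prop

theorem indep_colSum (h : IsSubgaussianArray ζ c μ) (a : EuclideanSpace ℝ V) :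
    iIndepFun (colSum ζ a) μ :=
  (iIndepFun_curry (fun q : T × V => h.swap.measurable q.1 q.2) h.swap.indep).comp
    (fun _ x => ∑ v, a v * x v) fun _ => by fun_prop

theorem subgaussian_colSum (h : IsSubgaussianArray ζ c μ) {a : EuclideanSpace ℝ V} (ha : ‖a‖ ≤ 1)
    (t : T) : HasSubgaussianMGF (colSum ζ a t) c μ := by
  have h1 := HasSubgaussianMGF.sum_of_iIndepFun (h.indep_column a t) (s := Finset.univ)
    (c := fun v => ‖a v‖₊ ^ 2 * c) fun v _ => by
      have h0 := (h.subgaussian v t).const_mul (a v)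
      have h2 : ((‖a v‖₊ ^ 2 : NNReal) : ℝ) = a v ^ 2 := by
        rw [NNReal.coe_pow, coe_nnnorm, Real.norm_eq_abs, sq_abs]
      refine ⟨h0.integrable_exp_mul, fun s => (h0.mgf_le s).trans (le_of_eq ?_)⟩
      rw [NNReal.coe_mul, h2]
      rfl
  refine ⟨h1.integrable_exp_mul, fun s => (h1.mgf_le s).trans ?_⟩
  rw [Real.exp_le_exp]
  have h2 : ∑ v, (a v) ^ 2 ≤ 1 := by
    have := EuclideanSpace.real_norm_sq_eq a
    rw [← this]
    exact pow_le_one₀ (norm_nonneg _) ha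
  push_cast
  simp only [Real.norm_eq_abs, sq_abs]
  rw [← Finset.sum_mul]
  have h3 : (∑ v, (a v) ^ 2) * (c : ℝ) ≤ c := by
    have := c.coe_nonneg
    nlinarith
  have h4 : 0 ≤ s ^ 2 := sq_nonneg s
  have := mul_le_mul_of_nonneg_right h3 h4
  linarith

theorem integral_colSum_sq (h : IsSubgaussianArray ζ c μ) (a : EuclideanSpace ℝ V) (t : T) :
    ∫ ω, colSum ζ a t ω ^ 2 ∂μ = ‖a‖ ^ 2 := by
  have := h.isProbabilityMeasure
  have hL : ∀ v ∈ Finset.univ, MemLp (fun ω => a v * ζ v t ω) 2 μ := fun v _ =>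
    ((h.subgaussian v t).memLp 2).const_mul _
  have hv := IndepFun.variance_sum hL fun i _ j _ hij => (h.indep_column a t).indepFun hij
  have he : (∑ v, fun ω => a v * ζ v t ω) = colSum ζ a t := by
    funext ω; simp [colSum]
  have h0 : ∫ ω, colSum ζ a t ω ∂μ = 0 := by
    unfold colSum
    rw [integral_finsetSum _ fun v _ => ((h.subgaussian v t).integrable.const_mul _)]
    simp [integral_const_mul, h.integral_eq_zero]
  have h1 : ∀ v, variance (fun ω => a v * ζ v t ω) μ = a v ^ 2 := fun v => by
    rw [variance_const_mul, variance_of_integral_eq_zero (h.measurable v t).aemeasurable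
      (h.integral_eq_zero v t), h.integral_sq, mul_one]
  rw [he, variance_of_integral_eq_zero (h.measurable_colSum a t).aemeasurable h0] at hv
  rw [hv, EuclideanSpace.real_norm_sq_eq]
  exact Finset.sum_congr rfl fun v _ => h1 v

/-- By independence the characteristic function is a product. Factors in `J`, where the expansion
near the origin is valid, give Gaussian decay; the others are bounded by 1. -/
theorem norm_charFun_colSum_le (h : IsSubgaussianArray ζ c μ) {M : ℝ}
    (hM : ∀ v t, ∫ ω, ζ v t ω ^ 4 ∂μ ≤ M) (a : EuclideanSpace ℝ V) (t : T) {s : ℝ}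
    (J : Finset V) (hJ : ∀ v ∈ J, (a v * s) ^ 2 * (1 + M) ≤ 1) :
    ‖charFun (μ.map (colSum ζ a t)) s‖ ≤ Real.exp (-(∑ v ∈ J, a v ^ 2) / 8 * s ^ 2) := by
  classical
  have := h.isProbabilityMeasure
  have h1 := (h.indep_column a t).charFun_map_fun_sum_eq_prod
    fun v => ((h.measurable v t).const_mul (a v)).aemeasurable
  have h2 : charFun (μ.map (colSum ζ a t)) s = ∏ v, charFun (μ.map (ζ v t)) (a v * s) := by
    have h3 := congrFun h1 s
    rw [Finset.prod_apply] at h3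
    unfold colSum
    rw [h3]
    exact Finset.prod_congr rfl fun v _ => charFun_map_mul_comp (h.measurable v t).aemeasurable _ _
  have hp : ∀ v, IsProbabilityMeasure (μ.map (ζ v t)) := fun v =>
    Measure.isProbabilityMeasure_map (h.measurable v t).aemeasurable
  rw [h2, norm_prod]
  calc ∏ v, ‖charFun (μ.map (ζ v t)) (a v * s)‖
      ≤ ∏ v, (if v ∈ J then Real.exp (-(a v * s) ^ 2 / 8) else 1) := by
        refine Finset.prod_le_prod (fun _ _ => norm_nonneg _) fun v _ => ?_
        split_ifs with hv
        · exact norm_charFun_le_exp (h.subgaussian v t) (h.measurable v t)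
            (h.integral_eq_zero v t) (h.integral_sq v t) (hM v t) (hJ v hv)
        · exact norm_charFun_le_one _
    _ = _ := by
        rw [Finset.prod_ite_mem, Finset.univ_inter, ← Real.exp_sum]
        congr 1
        rw [← Finset.sum_neg_distrib, Finset.sum_div, Finset.sum_mul]
        exact Finset.sum_congr rfl fun v _ => by ring

/-- The Laplace transform of `ξ²` for a combination `ξ` with a positive proportion of coordinates
of order `1 / √d`. -/
theorem integral_exp_neg_colSum_sq_le (h : IsSubgaussianArray ζ c μ) {M : ℝ} (hM0 : 0 ≤ M)
    (hM : ∀ v t, ∫ ω, ζ v t ω ^ 4 ∂μ ≤ M) {a : EuclideanSpace ℝ V} (ha : ‖a‖ ≤ 1) (τ : T)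
    {δ η t : ℝ} (hδ : 0 < δ) (hη : 0 < η) (ht : 0 ≤ t) (hd : 0 < Fintype.card V)
    (hs : δ * Fintype.card V ≤
      ((Finset.univ.filter fun v => η / √(Fintype.card V) ≤ |a v|).card : ℝ)) :
    ∫ ω, Real.exp (-t * colSum ζ a τ ω ^ 2) ∂μ ≤
      (√(1 + δ * η ^ 2 / 4 * t))⁻¹ + 4 * (1 + M) / δ * t / Fintype.card V := by
  classical
  have := h.isProbabilityMeasure
  set d : ℝ := (Fintype.card V : ℝ) with hdd
  have hd0 : 0 < d := Nat.cast_pos.2 hd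
  set J0 := Finset.univ.filter fun v => η / √d ≤ |a v| with hJ0
  -- Coordinates that are too large would leave the range of the decay estimate. Since ‖a‖ ≤ 1, at
  -- most δd/2 of them satisfy a_v²d > 2/δ, so at least δd/2 coordinates of order 1/√d remain.
  set B := Finset.univ.filter fun v => 2 / δ < a v ^ 2 * d with hB
  have hnorm : ∑ v, a v ^ 2 ≤ 1 := by
    rw [← EuclideanSpace.real_norm_sq_eq a]; exact pow_le_one₀ (norm_nonneg _) ha
  have hBc : (B.card : ℝ) ≤ δ / 2 * d := by
    have h1 : (B.card : ℝ) * (2 / δ) ≤ ∑ v, a v ^ 2 * d := by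
      calc (B.card : ℝ) * (2 / δ) = ∑ v ∈ B, 2 / δ := by rw [Finset.sum_const, nsmul_eq_mul]
        _ ≤ ∑ v ∈ B, a v ^ 2 * d := Finset.sum_le_sum fun v hv => (Finset.mem_filter.1 hv).2.le
        _ ≤ ∑ v, a v ^ 2 * d := Finset.sum_le_sum_of_subset_of_nonneg (Finset.subset_univ _)
            fun v _ _ => by positivity
    rw [← Finset.sum_mul] at h1
    have h2 : (B.card : ℝ) * (2 / δ) ≤ d := by nlinarith
    rw [← mul_div_assoc, div_le_iff₀ hδ] at h2
    linarith
  have hJc : δ / 2 * d ≤ ((J0 \ B).card : ℝ) := by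
    have h1 : (J0.card : ℝ) ≤ (J0 \ B).card + B.card := by
      exact_mod_cast Finset.card_le_card_sdiff_add_card
    linarith
  have hsum : δ * η ^ 2 / 2 ≤ ∑ v ∈ J0 \ B, a v ^ 2 := by
    calc δ * η ^ 2 / 2 = (δ / 2 * d) * (η ^ 2 / d) := by field_simp
      _ ≤ ((J0 \ B).card : ℝ) * (η ^ 2 / d) := by gcongr
      _ = ∑ v ∈ J0 \ B, η ^ 2 / d := by rw [Finset.sum_const, nsmul_eq_mul]
      _ ≤ _ := Finset.sum_le_sum fun v hv => by
        have h1 := (Finset.mem_filter.1 (Finset.mem_sdiff.1 hv).1).2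
        have h2 := pow_le_pow_left₀ (by positivity) h1 2
        rwa [div_pow, Real.sq_sqrt hd0.le, sq_abs] at h2
  -- The largest radius for which a_v² ≤ 2/(δd) guarantees (a_v s)²(1 + M) ≤ 1.
  set R : ℝ := √(d * δ / (2 * (1 + M))) with hR
  have hR2 : R ^ 2 = d * δ / (2 * (1 + M)) := Real.sq_sqrt (by positivity)
  have hR0 : 0 < R := Real.sqrt_pos.2 (by positivity)
  have hcf : ∀ s, |s| ≤ R → ‖charFun (μ.map (colSum ζ a τ)) s‖ ≤
      Real.exp (-(δ * η ^ 2 / 16) * s ^ 2) := fun s hs' => by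
    have hs2 : s ^ 2 ≤ R ^ 2 := by
      rw [← sq_abs]; exact pow_le_pow_left₀ (abs_nonneg _) hs' 2
    refine (h.norm_charFun_colSum_le hM a τ (J0 \ B) fun v hv => ?_).trans ?_
    · have h1 : a v ^ 2 * d ≤ 2 / δ := by
        have := (Finset.mem_sdiff.1 hv).2
        simp only [hB, Finset.mem_filter, Finset.mem_univ, true_and, not_lt] at this
        exact this
      rw [mul_pow]
      have h2 : a v ^ 2 * s ^ 2 * (1 + M) ≤ a v ^ 2 * R ^ 2 * (1 + M) := by gcongr
      have h3 : a v ^ 2 * R ^ 2 * (1 + M) = a v ^ 2 * d * (δ / 2) := by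
        rw [hR2]; field_simp
      have h4 : a v ^ 2 * d * (δ / 2) ≤ 2 / δ * (δ / 2) := by gcongr
      have h5 : 2 / δ * (δ / 2) = 1 := by field_simp
      linarith
    · rw [Real.exp_le_exp]
      have := sq_nonneg s
      nlinarith
  refine (integral_exp_neg_sq_le_of_charFun_decay (h.measurable_colSum a τ) ht (by positivity) hR0
    hcf).trans (le_of_eq ?_)
  rw [hR2]
  congr 1
  · ring_nf
  · field_simp
    ring

variable {w : T → ℝ}

theorem indep_sq (h : IsSubgaussianArray ζ c μ) (a : EuclideanSpace ℝ V) :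
    iIndepFun (fun t ω => w t * colSum ζ a t ω ^ 2) μ :=
  (h.indep_colSum a).comp (fun t x => w t * x ^ 2) fun t => by fun_prop

variable [Fintype T]

/-- Writing exp(u w ξ²) = (exp(uξ²))^w with w in [0,1], Jensen's inequality bounds each factor by `A
^ w`. By independence the weights add up in the exponent, so weighted columns count as `∑ t, w t`
full columns. -/
theorem mgf_quadForm_le (h : IsSubgaussianArray ζ c μ) (a : EuclideanSpace ℝ V)
    (hw0 : ∀ t, 0 ≤ w t) (hw1 : ∀ t, w t ≤ 1) {u A : ℝ} (hA : 0 < A)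
    (hi : ∀ t, Integrable (fun ω => Real.exp (u * colSum ζ a t ω ^ 2)) μ)
    (hle : ∀ t, ∫ ω, Real.exp (u * colSum ζ a t ω ^ 2) ∂μ ≤ A) :
    Integrable (fun ω => Real.exp (u * quadForm ζ w a ω)) μ ∧
      mgf (quadForm ζ w a) μ u ≤ A ^ ∑ t, w t := by
  have := h.isProbabilityMeasure
  have hm : ∀ t, Measurable (fun ω => w t * colSum ζ a t ω ^ 2) := fun t => by
    have := h.measurable_colSum a t
    fun_prop
  have he : (∑ t, fun ω => w t * colSum ζ a t ω ^ 2) = quadForm ζ w a := by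
    funext ω; simp [quadForm]
  have h1 : ∀ t, (fun ω => Real.exp (u * (w t * colSum ζ a t ω ^ 2))) =
      fun ω => Real.exp (u * colSum ζ a t ω ^ 2) ^ w t := fun t => by
    funext ω
    rw [← Real.exp_mul]
    ring_nf
  have h2 := fun t => integral_rpow_le_rpow (fun ω => (Real.exp_pos _).le) (hi t) hA (hle t)
    (hw0 t) (hw1 t) (by
      rw [← h1]
      exact (((hm t).const_mul u).exp).aestronglyMeasurable)
  constructor
  · rw [← he]
    exact (h.indep_sq a).integrable_exp_mul_sum hm fun t _ => by
      rw [h1]; exact (h2 t).1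
  · rw [← he, (h.indep_sq a).mgf_sum hm, Real.rpow_sum_of_pos hA]
    refine Finset.prod_le_prod (fun _ _ => mgf_nonneg) fun t _ => ?_
    rw [mgf, h1]
    exact (h2 t).2

theorem measureReal_le_quadForm (h : IsSubgaussianArray ζ c μ) (hc : 0 < c)
    {a : EuclideanSpace ℝ V} (ha : ‖a‖ ≤ 1) (hw0 : ∀ t, 0 ≤ w t) (hw1 : ∀ t, w t ≤ 1) (K : ℝ) :
    μ.real {ω | 4 * c * K * (∑ t, w t) ≤ quadForm ζ w a ω} ≤
      Real.exp ((1 - K) * ∑ t, w t) := by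
  have := h.isProbabilityMeasure
  have hc' : (0 : ℝ) < c := by exact_mod_cast hc
  obtain ⟨h1, h2⟩ := h.mgf_quadForm_le a hw0 hw1 two_pos
    (fun t => integrable_exp_sq (h.subgaussian_colSum ha t) hc (h.measurable_colSum a t))
    (fun t => integral_exp_sq_le (h.subgaussian_colSum ha t) hc (h.measurable_colSum a t))
  refine (measure_ge_le_exp_mul_mgf _ (by positivity) h1).trans ?_
  have hS : 0 ≤ ∑ t, w t := Finset.sum_nonneg fun t _ => hw0 t
  have h3 : (2 : ℝ) ^ (∑ t, w t) ≤ Real.exp (∑ t, w t) := by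
    rw [← Real.exp_one_rpow]
    exact Real.rpow_le_rpow two_pos.le (by linarith [Real.exp_one_gt_d9]) hS
  calc _ ≤ Real.exp (-(4 * (c : ℝ))⁻¹ * (4 * c * K * ∑ t, w t)) * Real.exp (∑ t, w t) := by
        gcongr; exact h2.trans h3
    _ = _ := by
        rw [← Real.exp_add]; congr 1; field_simp; ring

theorem measureReal_quadForm_le (h : IsSubgaussianArray ζ c μ) (a : EuclideanSpace ℝ V)
    (hw0 : ∀ t, 0 ≤ w t) (hw1 : ∀ t, w t ≤ 1) {u A : ℝ} (hu : 0 ≤ u) (hA : 0 < A)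
    (hle : ∀ t, ∫ ω, Real.exp (-u * colSum ζ a t ω ^ 2) ∂μ ≤ A) (y : ℝ) :
    μ.real {ω | quadForm ζ w a ω ≤ y} ≤ Real.exp (u * y) * A ^ ∑ t, w t := by
  have := h.isProbabilityMeasure
  obtain ⟨h1, h2⟩ := h.mgf_quadForm_le a hw0 hw1 hA
    (fun t => integrable_exp_neg_sq (h.measurable_colSum a t) hu) hle
  refine (measure_le_le_exp_mul_mgf y (by linarith) h1).trans ?_
  rw [neg_neg]
  gcongr

theorem measureReal_quadForm_le_of_half_le (h : IsSubgaussianArray ζ c μ) (hc : 0 < c)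
    {a : EuclideanSpace ℝ V} (ha : ‖a‖ ≤ 1) (ha' : 1 / 2 ≤ ‖a‖) (hw0 : ∀ t, 0 ≤ w t)
    (hw1 : ∀ t, w t ≤ 1) :
    μ.real {ω | quadForm ζ w a ω ≤ (∑ t, w t) / 16} ≤
      Real.exp (-(4096 * (c : ℝ) ^ 2)⁻¹ * ∑ t, w t) := by
  have := h.isProbabilityMeasure
  have hc' : (0 : ℝ) < c := by exact_mod_cast hc
  -- With fourth moments at most 64c², this u makes the quadratic term u/8, half of the linear gain
  -- u‖a‖² ≥ u/4. The threshold ∑w/16 then costs half of the remaining u/8.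
  set u : ℝ := (256 * (c : ℝ) ^ 2)⁻¹ with hu
  have hu0 : 0 < u := by positivity
  have hle : ∀ t, ∫ ω, Real.exp (-u * colSum ζ a t ω ^ 2) ∂μ ≤ Real.exp (-u / 8) := fun t => by
    refine (integral_exp_neg_sq_le (h.subgaussian_colSum ha t) (h.measurable_colSum a t)
      (h.integral_colSum_sq a t) (integral_pow_four_le (h.subgaussian_colSum ha t) hc
        (h.measurable_colSum a t)) hu0.le).trans ?_
    rw [Real.exp_le_exp]
    have h1 : u ^ 2 * (64 * (c : ℝ) ^ 2) = u / 4 := by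
      rw [sq, mul_assoc]
      have : u * (64 * (c : ℝ) ^ 2) = 1 / 4 := by rw [hu]; field_simp; norm_num
      rw [this]; ring
    have h2 : 1 / 4 ≤ ‖a‖ ^ 2 := by nlinarith
    rw [h1]
    nlinarith
  refine (h.measureReal_quadForm_le a hw0 hw1 hu0.le (Real.exp_pos _) hle _).trans (le_of_eq ?_)
  rw [← Real.exp_mul, ← Real.exp_add]
  congr 1
  have h4 : (4096 * (c : ℝ) ^ 2)⁻¹ = u / 16 := by
    rw [hu]; field_simp; norm_num
  rw [h4]
  ring

end IsSubgaussianArray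

/-! ### Extreme singular values of subgaussian arrays -/

/-- The linear map with matrix entries `√(w t) * ζ v t`. -/
noncomputable def arrayMap {Ω V T : Type*} [Fintype V] [Fintype T] (ζ : V → T → Ω → ℝ) (w : T → ℝ)
    (ω : Ω) : EuclideanSpace ℝ V →L[ℝ] EuclideanSpace ℝ T :=
  LinearMap.toContinuousLinearMap
    { toFun := fun a => WithLp.toLp 2 fun t => √(w t) * colSum ζ a t ω
      map_add' := fun a b => by
        ext t
        simp only [colSum, PiLp.add_apply, add_mul, Finset.sum_add_distrib, mul_add]
      map_smul' := fun r a => by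
        ext t
        simp only [colSum, PiLp.smul_apply, smul_eq_mul, RingHom.id_apply, Finset.mul_sum]
        exact Finset.sum_congr rfl fun v _ => by ring }

theorem norm_arrayMap_sq {Ω V T : Type*} [Fintype V] [Fintype T] (ζ : V → T → Ω → ℝ) {w : T → ℝ}
    (hw : ∀ t, 0 ≤ w t) (ω : Ω) (a : EuclideanSpace ℝ V) :
    ‖arrayMap ζ w ω a‖ ^ 2 = quadForm ζ w a ω := by
  rw [EuclideanSpace.real_norm_sq_eq]
  refine Finset.sum_congr rfl fun t _ => ?_
  change (√(w t) * colSum ζ a t ω) ^ 2 = _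
  rw [mul_pow, Real.sq_sqrt (hw t)]

theorem le_norm_of_unit {E F : Type*} [NormedAddCommGroup E] [NormedSpace ℝ E]
    [NormedAddCommGroup F] [NormedSpace ℝ F] (L : E →L[ℝ] F) {r : ℝ}
    (h : ∀ a, ‖a‖ = 1 → r ≤ ‖L a‖) (a : E) : r * ‖a‖ ≤ ‖L a‖ := by
  rcases eq_or_ne a 0 with rfl | ha
  · simp
  · have hn : 0 < ‖a‖ := norm_pos_iff.2 ha
    have h1 := h (‖a‖⁻¹ • a) (by rw [norm_smul, norm_inv, norm_norm, inv_mul_cancel₀ hn.ne'])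
    rwa [map_smul, norm_smul, norm_inv, norm_norm, inv_mul_eq_div, le_div_iff₀ hn] at h1

theorem measureReal_biUnion_le_card_mul {Ω ι : Type*} [MeasurableSpace Ω] {μ : Measure Ω}
    [IsProbabilityMeasure μ] (F : Finset ι) (E : ι → Set Ω) {q N : ℝ} (hq : 0 ≤ q)
    (hF : (F.card : ℝ) ≤ N) (h : ∀ i ∈ F, μ.real (E i) ≤ q) :
    μ.real (⋃ i ∈ F, E i) ≤ N * q := by
  refine (measureReal_biUnion_finset_le F E).trans ((Finset.sum_le_sum h).trans ?_)
  rw [Finset.sum_const, nsmul_eq_mul]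
  gcongr

/-- Sparse vectors have small entropy: a large γ makes nonzero entries rare at cost γδd, which is
small once δ is small compared with 1/γ. The ℓ¹ penalty, the sparsity penalty and the product over
coordinates each contribute one third of the exponent. -/
theorem exists_card_latticeBall_le_exp {ε c : ℝ} (hε : 0 < ε) (hc : 0 < c) :
    ∃ δ : ℝ, 0 < δ ∧ ∀ (V : Type) [Fintype V] [DecidableEq V],
      ((latticeBall V (Fintype.card V / ε) (δ * Fintype.card V)).card : ℝ) ≤
        Real.exp (c * Fintype.card V) := by
  set η := c / 3 with hη
  have hη0 : 0 < η := by positivity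
  set γ := 2 / (η ^ 2 * ε) with hγ
  have hγ0 : 0 < γ := by positivity
  refine ⟨η / γ, by positivity, fun V _ _ => ?_⟩
  refine (card_latticeBall_le (β := η * ε) (γ := γ) (by positivity) hγ0.le).trans ?_
  have h1 : 2 * Real.exp (-γ) / (η * ε) ≤ η := by
    have h2 : Real.exp (-γ) ≤ 1 / γ := by
      rw [Real.exp_neg, ← one_div]
      exact one_div_le_one_div_of_le hγ0 (by linarith [Real.add_one_le_exp γ])
    rw [div_le_iff₀ (by positivity)]
    calc 2 * Real.exp (-γ) ≤ 2 * (1 / γ) := by gcongr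
      _ = η * (η * ε) := by rw [hγ]; field_simp
  have h3 : 1 + 2 * Real.exp (-γ) / (η * ε) ≤ Real.exp η := by
    linarith [Real.add_one_le_exp η]
  calc _ ≤ Real.exp (η * ε * (Fintype.card V / ε) + γ * (η / γ * Fintype.card V)) *
        Real.exp η ^ Fintype.card V := by gcongr
    _ = _ := by
      rw [← Real.exp_nat_mul, ← Real.exp_add]
      congr 1
      field_simp
      rw [hη]
      ring

namespace IsSubgaussianArray

variable {Ω V T : Type*} [MeasurableSpace Ω] {μ : Measure Ω} {ζ : V → T → Ω → ℝ} {c : NNReal}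
  [Fintype V] [Fintype T] {w : T → ℝ}

/-- A net of mesh 1/2 has at most 18^d ≤ e^(3d) points, and the Chernoff bound with K = 5 gives
probability e^(−4S) at each, where S is the total weight. Passing from the net to the sphere doubles
√(20cS) into √(80cS). -/
theorem measureReal_lt_opNorm_le (h : IsSubgaussianArray ζ c μ) (hc : 0 < c) (hw0 : ∀ t, 0 ≤ w t)
    (hw1 : ∀ t, w t ≤ 1) (hd : (Fintype.card V : ℝ) ≤ ∑ t, w t) :
    μ.real {ω | √(80 * c) * √(∑ t, w t) < ‖arrayMap ζ w ω‖} ≤ Real.exp (-∑ t, w t) := by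
  classical
  have := h.isProbabilityMeasure
  set S := ∑ t, w t with hS
  have hS0 : 0 ≤ S := Finset.sum_nonneg fun t _ => hw0 t
  set F := (latticeBall V (Fintype.card V / (1 / 2 : ℝ)) (Fintype.card V)).filter
    fun m => ‖latticePoint (1 / 2) m‖ ≤ 1 with hF
  have hsub : {ω | √(80 * c) * √S < ‖arrayMap ζ w ω‖} ⊆
      ⋃ m ∈ F, {ω | 4 * c * 5 * S ≤ quadForm ζ w (latticePoint (1 / 2) m) ω} := by
    intro ω hω
    by_contra hcon
    simp only [Set.mem_iUnion, Set.mem_ofPred_eq, not_exists, not_le, hF, Finset.mem_filter] at hcon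
    have h1 := opNorm_le_of_latticePoint (arrayMap ζ w ω) (A := √(4 * c * 5 * S))
      (Real.sqrt_nonneg _) fun m hm hm1 => by
        refine Real.le_sqrt_of_sq_le ?_
        rw [norm_arrayMap_sq ζ hw0]
        exact (hcon m ⟨hm, hm1⟩).le
    have h2 : √(80 * c) * √S = 2 * √(4 * c * 5 * S) := by
      rw [← Real.sqrt_mul (by positivity), show (80 * c * S : ℝ) = 2 ^ 2 * (4 * c * 5 * S) by ring,
        Real.sqrt_mul (by positivity), Real.sqrt_sq (by norm_num)]
    rw [← h2] at h1
    exact absurd hω (not_lt.2 h1)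
  have hcard : (F.card : ℝ) ≤ Real.exp (3 * S) := by
    have h1 : (F.card : ℝ) ≤ (9 / (1 / 2)) ^ Fintype.card V :=
      (Nat.cast_le.2 (Finset.card_filter_le _ _)).trans
        (card_latticeBall_le' (by norm_num) (by norm_num) _)
    have h2 : (9 / (1 / 2) : ℝ) ≤ Real.exp 3 := by
      have h3 : Real.exp 3 = Real.exp 1 ^ 3 := by rw [← Real.exp_nat_mul]; norm_num
      rw [h3]
      have h4 := pow_le_pow_left₀ (by norm_num) Real.exp_one_gt_d9.le 3
      exact le_trans (by norm_num) h4
    calc (F.card : ℝ) ≤ Real.exp 3 ^ Fintype.card V := h1.trans (by gcongr)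
      _ = Real.exp (3 * Fintype.card V) := by rw [← Real.exp_nat_mul, mul_comm]
      _ ≤ _ := by gcongr
  refine (measureReal_mono hsub (measure_ne_top _ _)).trans ((measureReal_biUnion_le_card_mul F _ (Real.exp_pos _).le
    hcard fun m hm => h.measureReal_le_quadForm hc (Finset.mem_filter.1 hm).2 hw0 hw1 5).trans ?_)
  rw [← Real.exp_add]
  gcongr
  linarith

/-- The vectors with few coordinates above `ε / √d` are not much contracted. -/
theorem measureReal_sparse_le [DecidableEq V] (h : IsSubgaussianArray ζ c μ) (hc : 0 < c)
    (hw0 : ∀ t, 0 ≤ w t) (hw1 : ∀ t, w t ≤ 1) {ε : ℝ} (hε : 0 < ε) (hε2 : ε ≤ 1 / 2)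
    (hεc : ε * √(80 * c) ≤ 1 / 8) (s : ℝ) :
    μ.real {ω | ‖arrayMap ζ w ω‖ ≤ √(80 * c) * √(∑ t, w t) ∧ ∃ a : EuclideanSpace ℝ V, ‖a‖ = 1 ∧
      ((Finset.univ.filter fun v => ε / √(Fintype.card V) ≤ |a v|).card : ℝ) ≤ s ∧
        ‖arrayMap ζ w ω a‖ < √(∑ t, w t) / 8} ≤
      (latticeBall V (Fintype.card V / ε) s).card *
        Real.exp (-(4096 * (c : ℝ) ^ 2)⁻¹ * ∑ t, w t) := by
  have := h.isProbabilityMeasure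
  set S := ∑ t, w t with hS
  have hS0 : 0 ≤ S := Finset.sum_nonneg fun t _ => hw0 t
  set F := (latticeBall V (Fintype.card V / ε) s).filter
    fun m => ‖latticePoint ε m‖ ≤ 1 ∧ 1 / 2 ≤ ‖latticePoint ε m‖ with hF
  refine (measureReal_mono (s₂ := ⋃ m ∈ F, {ω | quadForm ζ w (latticePoint ε m) ω ≤ S / 16})
    ?_ (measure_ne_top _ _)).trans
    (measureReal_biUnion_le_card_mul F _ (Real.exp_pos _).le
      (Nat.cast_le.2 (Finset.card_filter_le _ _)) fun m hm =>
        h.measureReal_quadForm_le_of_half_le hc (Finset.mem_filter.1 hm).2.1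
          (Finset.mem_filter.1 hm).2.2 hw0 hw1)
  rintro ω ⟨hop, a, ha, hs, hlt⟩
  have h1 := norm_sub_latticePoint_round_le hε a
  have h2 := norm_latticePoint_round_le hε a
  have h3 := latticeRound_mem hε ha.le hs
  set a' := latticePoint ε (latticeRound ε a) with ha'
  have h4 : ‖a‖ ≤ ‖a'‖ + ‖a - a'‖ := by
    have := norm_add_le a' (a - a'); rwa [add_sub_cancel] at this
  simp only [Set.mem_iUnion, exists_prop]
  refine ⟨latticeRound ε a, Finset.mem_filter.2 ⟨h3, ?_, ?_⟩, ?_⟩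
  · rw [← ha']; linarith
  · rw [← ha']; linarith
  · have h5 : ‖arrayMap ζ w ω a'‖ ≤ ‖arrayMap ζ w ω a‖ + ‖arrayMap ζ w ω (a - a')‖ := by
      have := norm_sub_le (arrayMap ζ w ω a) (arrayMap ζ w ω (a - a'))
      rwa [← map_sub, sub_sub_cancel] at this
    have h6 : ‖arrayMap ζ w ω (a - a')‖ ≤ 1 / 8 * √S := by
      calc _ ≤ ‖arrayMap ζ w ω‖ * ‖a - a'‖ := (arrayMap ζ w ω).le_opNorm _
        _ ≤ (√(80 * c) * √S) * ε := by gcongr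
        _ = ε * √(80 * c) * √S := by ring
        _ ≤ _ := by gcongr
    -- The smallness of ε√(80c) is chosen so that rounding costs no more than the assumed √S/8; the
    -- square S/16 is the threshold of the pointwise estimate.
    have h7 : ‖arrayMap ζ w ω a'‖ ≤ √S / 4 := by linarith
    have h8 := pow_le_pow_left₀ (norm_nonneg _) h7 2
    rw [norm_arrayMap_sq ζ hw0, div_pow, Real.sq_sqrt hS0] at h8
    exact h8.trans (by norm_num)

/-- The vectors with many coordinates above `ε / √d` are not much contracted. -/
theorem measureReal_spread_le [DecidableEq V] (h : IsSubgaussianArray ζ c μ) (hc : 0 < c)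
    (hw0 : ∀ t, 0 ≤ w t) (hw1 : ∀ t, w t ≤ 1) (hd : 0 < Fintype.card V) {ε δ q A : ℝ}
    (hε : 0 < ε) (hδ : 0 < δ) (hq : 0 < q) (hqε : 1 ≤ ε * √(80 * c) * q)
    (hqc : 1 ≤ √(80 * c) * q)
    (hA : (√(1 + δ * (ε / 2) ^ 2 / 4 * q ^ 2))⁻¹ +
      4 * (1 + 64 * (c : ℝ) ^ 2) / δ * q ^ 2 / Fintype.card V ≤ A) :
    μ.real {ω | ‖arrayMap ζ w ω‖ ≤ √(80 * c) * √(∑ t, w t) ∧ ∃ a : EuclideanSpace ℝ V, ‖a‖ = 1 ∧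
      δ * Fintype.card V ≤
        ((Finset.univ.filter fun v => ε / √(Fintype.card V) ≤ |a v|).card : ℝ) ∧
        ‖arrayMap ζ w ω a‖ < √(∑ t, w t) / (2 * q)} ≤
      (18 * √(80 * c) * q) ^ Fintype.card V * (Real.exp 1 * A) ^ ∑ t, w t := by
  have := h.isProbabilityMeasure
  have hc' : (0 : ℝ) < c := by exact_mod_cast hc
  set S := ∑ t, w t with hS
  have hS0 : 0 ≤ S := Finset.sum_nonneg fun t _ => hw0 t
  set B : ℝ := √(80 * c) with hB
  have hB0 : 0 < B := Real.sqrt_pos.2 (by positivity)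
  -- On the event that the operator norm is at most B√S, this mesh moves the image by at most
  -- √S/(2q). It is also at most ε/2, so rounding keeps the large coordinates above (ε/2)/√d.
  set ε' : ℝ := (2 * B * q)⁻¹ with hε'
  have hε'0 : 0 < ε' := by positivity
  have hε'1 : ε' ≤ 1 := by
    rw [hε']; exact inv_le_one_of_one_le₀ (by linarith)
  have hε'ε : ε' ≤ ε / 2 := by
    rw [hε', inv_le_iff_one_le_mul₀ (by positivity)]; linarith
  have hA0 : 0 < A := by
    refine lt_of_lt_of_le ?_ hA
    positivity
  set F := (latticeBall V (Fintype.card V / ε') (Fintype.card V)).filter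
    fun m => ‖latticePoint ε' m‖ ≤ 1 ∧ δ * Fintype.card V ≤ ((Finset.univ.filter fun v =>
      (ε / 2) / √(Fintype.card V) ≤ |latticePoint ε' m v|).card : ℝ) with hF
  have hcard : (F.card : ℝ) ≤ (18 * B * q) ^ Fintype.card V := by
    have h1 : (F.card : ℝ) ≤ (9 / ε') ^ Fintype.card V :=
      (Nat.cast_le.2 (Finset.card_filter_le _ _)).trans (card_latticeBall_le' hε'0 hε'1 _)
    refine h1.trans (le_of_eq ?_)
    rw [hε', div_inv_eq_mul]
    ring_nf
  have hsub : {ω | ‖arrayMap ζ w ω‖ ≤ B * √S ∧ ∃ a : EuclideanSpace ℝ V, ‖a‖ = 1 ∧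
      δ * Fintype.card V ≤
        ((Finset.univ.filter fun v => ε / √(Fintype.card V) ≤ |a v|).card : ℝ) ∧
        ‖arrayMap ζ w ω a‖ < √S / (2 * q)} ⊆
      ⋃ m ∈ F, {ω | quadForm ζ w (latticePoint ε' m) ω ≤ S / q ^ 2} := by
    rintro ω ⟨hop, a, ha, hs, hlt⟩
    have h1 := norm_sub_latticePoint_round_le hε'0 a
    have h2 := norm_latticePoint_round_le hε'0 a
    have h3 := latticeRound_mem hε'0 ha.le (s := Fintype.card V)
      (by exact_mod_cast Finset.card_le_univ _)
    have h4 := abs_sub_latticePoint_round_le hε'0 a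
    set a' := latticePoint ε' (latticeRound ε' a) with ha'
    simp only [Set.mem_iUnion, exists_prop]
    refine ⟨latticeRound ε' a, Finset.mem_filter.2 ⟨h3, ?_, hs.trans ?_⟩, ?_⟩
    · rw [← ha']; linarith
    · refine Nat.cast_le.2 (Finset.card_le_card fun v hv => ?_)
      rw [Finset.mem_filter] at hv ⊢
      refine ⟨hv.1, ?_⟩
      rw [← ha']
      have h5 := h4 v
      have h6 := abs_sub_abs_le_abs_sub (a v) (a' v)
      have h7 : ε' / √(Fintype.card V) ≤ ε / 2 / √(Fintype.card V) := by gcongr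
      have h8 : ε / √(Fintype.card V) = ε / 2 / √(Fintype.card V) + ε / 2 / √(Fintype.card V) := by
        ring
      linarith [hv.2]
    · have h5 : ‖arrayMap ζ w ω a'‖ ≤ ‖arrayMap ζ w ω a‖ + ‖arrayMap ζ w ω (a - a')‖ := by
        have := norm_sub_le (arrayMap ζ w ω a) (arrayMap ζ w ω (a - a'))
        rwa [← map_sub, sub_sub_cancel] at this
      have h6 : ‖arrayMap ζ w ω (a - a')‖ ≤ √S / (2 * q) := by
        calc _ ≤ ‖arrayMap ζ w ω‖ * ‖a - a'‖ := (arrayMap ζ w ω).le_opNorm _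
          _ ≤ (B * √S) * ε' := by gcongr
          _ = _ := by rw [hε']; field_simp
      have h7 : ‖arrayMap ζ w ω a'‖ ≤ √S / q := by
        have : √S / q = √S / (2 * q) + √S / (2 * q) := by field_simp; norm_num
        linarith
      have h8 := pow_le_pow_left₀ (norm_nonneg _) h7 2
      rwa [norm_arrayMap_sq ζ hw0, div_pow, Real.sq_sqrt hS0] at h8
  have hpt : ∀ m ∈ F, μ.real {ω | quadForm ζ w (latticePoint ε' m) ω ≤ S / q ^ 2} ≤
      (Real.exp 1 * A) ^ S := fun m hm => by
    obtain ⟨hm1, hm2⟩ := (Finset.mem_filter.1 hm).2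
    have h4 : ∀ v t, ∫ ω, ζ v t ω ^ 4 ∂μ ≤ 64 * (c : ℝ) ^ 2 := fun v t =>
      integral_pow_four_le (h.subgaussian v t) hc (h.measurable v t)
    -- The Laplace parameter q² matches the threshold S/q², so the Chernoff factor is exactly e^S.
    refine (h.measureReal_quadForm_le (latticePoint ε' m) hw0 hw1 (sq_nonneg q) hA0 (fun t =>
      (h.integral_exp_neg_colSum_sq_le (by positivity) h4 hm1 t hδ (half_pos hε) (sq_nonneg q) hd
        hm2).trans hA) _).trans (le_of_eq ?_)
    rw [mul_div_cancel₀ _ (by positivity), Real.mul_rpow (Real.exp_pos _).le hA0.le,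
      Real.exp_one_rpow]
  exact (measureReal_mono hsub (measure_ne_top _ _)).trans
    (measureReal_biUnion_le_card_mul F _ (Real.rpow_nonneg (by positivity) _) hcard hpt)

end IsSubgaussianArray

theorem exists_mesh {c : NNReal} : ∃ ε : ℝ, 0 < ε ∧ ε ≤ 1 / 2 ∧ ε * √(80 * c) ≤ 1 / 8 := by
  refine ⟨(8 * √(80 * c) + 2)⁻¹, by positivity, ?_, ?_⟩
  · rw [inv_le_comm₀ (by positivity) (by norm_num)]
    have := Real.sqrt_nonneg (80 * c)
    norm_num
  · rw [inv_mul_le_iff₀ (by positivity)]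
    linarith

/-- The least singular value of a subgaussian array that is much longer than wide. -/
theorem exists_tall_lower_bound {c : NNReal} (hc : 0 < c) :
    ∃ C κ : ℝ, 1 ≤ C ∧ 0 < κ ∧ ∀ (Ω V T : Type) [MeasurableSpace Ω] [Fintype V] [Fintype T]
      (μ : Measure Ω) (ζ : V → T → Ω → ℝ) (w : T → ℝ), IsSubgaussianArray ζ c μ →
      (∀ t, 0 ≤ w t) → (∀ t, w t ≤ 1) → C * Fintype.card V ≤ ∑ t, w t →
      μ.real {ω | ¬ ∀ a, √(∑ t, w t) / 8 * ‖a‖ ≤ ‖arrayMap ζ w ω a‖} ≤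
        2 * Real.exp (-κ * ∑ t, w t) := by
  have hc' : (0 : ℝ) < c := by exact_mod_cast hc
  obtain ⟨ε, hε, hε2, hεc⟩ := exists_mesh (c := c)
  set c1 : ℝ := (4096 * (c : ℝ) ^ 2)⁻¹ with hc1
  have hc1' : 0 < c1 := by positivity
  have hlog : 0 < Real.log (9 / ε) := Real.log_pos (by rw [lt_div_iff₀ hε]; linarith)
  -- This aspect ratio makes the net of (9/ε)^d points cost at most half of the exponent c1 S. No
  -- spread case is needed: the sparse estimate is applied with sparsity level d, which every unit
  -- vector satisfies.
  refine ⟨1 + 2 * Real.log (9 / ε) / c1, min 1 (c1 / 2), by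
    have : 0 < 2 * Real.log (9 / ε) / c1 := by positivity
    linarith, by positivity, fun Ω V T _ _ _ μ ζ w h hw0 hw1 hd => ?_⟩
  classical
  have := h.isProbabilityMeasure
  set S := ∑ t, w t with hS
  have hS0 : 0 ≤ S := Finset.sum_nonneg fun t _ => hw0 t
  have hd0 : (0 : ℝ) ≤ Fintype.card V := Nat.cast_nonneg _
  rw [add_mul, one_mul] at hd
  have hr : 0 ≤ 2 * Real.log (9 / ε) / c1 * Fintype.card V := by positivity
  have hd1 : (Fintype.card V : ℝ) ≤ S := by linarith
  have hd2 : Real.log (9 / ε) * Fintype.card V ≤ c1 / 2 * S := by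
    have h1 : 2 * Real.log (9 / ε) / c1 * Fintype.card V ≤ S := by linarith
    have h2 := mul_le_mul_of_nonneg_left h1 (half_pos hc1').le
    calc _ = c1 / 2 * (2 * Real.log (9 / ε) / c1 * Fintype.card V) := by field_simp
      _ ≤ _ := h2
  have hsub : {ω | ¬ ∀ a, √S / 8 * ‖a‖ ≤ ‖arrayMap ζ w ω a‖} ⊆
      {ω | √(80 * c) * √S < ‖arrayMap ζ w ω‖} ∪
      {ω | ‖arrayMap ζ w ω‖ ≤ √(80 * c) * √S ∧ ∃ a : EuclideanSpace ℝ V, ‖a‖ = 1 ∧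
        ((Finset.univ.filter fun v => ε / √(Fintype.card V) ≤ |a v|).card : ℝ) ≤
          Fintype.card V ∧ ‖arrayMap ζ w ω a‖ < √S / 8} := by
    intro ω hω
    by_contra hcon
    simp only [Set.mem_union, Set.mem_ofPred_eq, not_or, not_lt, not_and, not_exists] at hcon
    exact hω (le_norm_of_unit _ fun a ha => hcon.2 hcon.1 a ha
      (Nat.cast_le.2 (Finset.card_le_univ _)))
  refine (measureReal_mono hsub (measure_ne_top _ _)).trans ((measureReal_union_le _ _).trans ?_)
  have h1 := h.measureReal_lt_opNorm_le hc hw0 hw1 hd1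
  have h2 := h.measureReal_sparse_le hc hw0 hw1 hε hε2 hεc (Fintype.card V)
  have h3 : Real.exp (-S) ≤ Real.exp (-min 1 (c1 / 2) * S) := by
    rw [Real.exp_le_exp]
    have := min_le_left 1 (c1 / 2)
    nlinarith
  have h4 : ((latticeBall V (Fintype.card V / ε) (Fintype.card V)).card : ℝ) *
      Real.exp (-c1 * S) ≤ Real.exp (-min 1 (c1 / 2) * S) := by
    calc _ ≤ (9 / ε) ^ Fintype.card V * Real.exp (-c1 * S) := by
          gcongr
          exact card_latticeBall_le' hε (by linarith) _
      _ = Real.exp (Real.log (9 / ε) * Fintype.card V) * Real.exp (-c1 * S) := by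
          rw [mul_comm (Real.log _), Real.exp_nat_mul, Real.exp_log (by positivity)]
      _ ≤ _ := by
          rw [← Real.exp_add, Real.exp_le_exp]
          have := min_le_right 1 (c1 / 2)
          nlinarith
  linarith

set_option maxHeartbeats 800000 in
/-- The least singular value of a subgaussian array with at least twice as many columns as rows,
the columns being counted with weights in `[0, 1]`. -/
theorem exists_wide_lower_bound {c : NNReal} (hc : 0 < c) :
    ∃ κ r N : ℝ, 0 < κ ∧ 0 < r ∧ 0 < N ∧ ∀ (Ω V T : Type) [MeasurableSpace Ω] [Fintype V]
      [Fintype T] (μ : Measure Ω) (ζ : V → T → Ω → ℝ) (w : T → ℝ), IsSubgaussianArray ζ c μ →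
      (∀ t, 0 ≤ w t) → (∀ t, w t ≤ 1) → N ≤ Fintype.card V → 2 * Fintype.card V ≤ ∑ t, w t →
      μ.real {ω | ¬ ∀ a, κ * √(∑ t, w t) * ‖a‖ ≤ ‖arrayMap ζ w ω a‖} ≤
        3 * Real.exp (-r * Fintype.card V) := by
  have hc' : (0 : ℝ) < c := by exact_mod_cast hc
  obtain ⟨ε, hε, hε2, hεc⟩ := exists_mesh (c := c)
  set c1 : ℝ := (4096 * (c : ℝ) ^ 2)⁻¹ with hc1
  have hc1' : 0 < c1 := by positivity
  obtain ⟨δ, hδ, hcard⟩ := exists_card_latticeBall_le_exp hε hc1'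
  set B : ℝ := √(80 * c) with hB
  have hB0 : 0 < B := Real.sqrt_pos.2 (by positivity)
  set C1 : ℝ := 4 / (ε * √δ) + 1 with hC1
  have hC10 : 0 < C1 := by positivity
  set E : ℝ := Real.exp 1 with hE
  have hE0 : 0 < E := Real.exp_pos 1
  -- The first summand wins the spread case, where 18Bq(EC1/q)² ≤ 1/E is needed. The second gives
  -- E·C1/q ≤ 1, and the last two are the conditions under which the spread mesh is fine enough.
  set q : ℝ := 18 * B * E ^ 3 * C1 ^ 2 + E * C1 + 1 / (ε * B) + 1 / B with hqdef
  have hq0 : 0 < q := by positivity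
  have hq1 : 18 * B * E ^ 3 * C1 ^ 2 ≤ q := by
    have : 0 ≤ E * C1 + 1 / (ε * B) + 1 / B := by positivity
    linarith only [this, hqdef]
  have hq2 : E * C1 ≤ q := by
    have : 0 ≤ 18 * B * E ^ 3 * C1 ^ 2 + 1 / (ε * B) + 1 / B := by positivity
    linarith only [this, hqdef]
  have hq3 : 1 / (ε * B) ≤ q := by
    have : 0 ≤ 18 * B * E ^ 3 * C1 ^ 2 + E * C1 + 1 / B := by positivity
    linarith only [this, hqdef]
  have hq4 : 1 / B ≤ q := by
    have : 0 ≤ 18 * B * E ^ 3 * C1 ^ 2 + E * C1 + 1 / (ε * B) := by positivity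
    linarith only [this, hqdef]
  rw [div_le_iff₀' (by positivity)] at hq3 hq4
  -- For d ≥ N the non-Gaussian error in the Laplace transform is at most 1/q, so the whole
  -- transform is at most C1/q.
  set N : ℝ := 4 * (1 + 64 * (c : ℝ) ^ 2) / δ * q ^ 3 with hN
  have hN0 : 0 < N := by positivity
  refine ⟨min (1 / 8) (1 / (2 * q)), min 1 c1, N, by positivity, by positivity, hN0,
    fun Ω V T _ _ _ μ ζ w h hw0 hw1 hd hd2 => ?_⟩
  classical
  have := h.isProbabilityMeasure
  set S := ∑ t, w t with hS
  have hS0 : 0 ≤ S := Finset.sum_nonneg fun t _ => hw0 t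
  set d : ℝ := (Fintype.card V : ℝ) with hdd
  have hd0 : 0 < d := hN0.trans_le hd
  have hdpos : 0 < Fintype.card V := Nat.cast_pos.1 hd0
  set A : ℝ := C1 / q with hA
  have hAle : (√(1 + δ * (ε / 2) ^ 2 / 4 * q ^ 2))⁻¹ +
      4 * (1 + 64 * (c : ℝ) ^ 2) / δ * q ^ 2 / d ≤ A := by
    have h1 : 4 * (1 + 64 * (c : ℝ) ^ 2) / δ * q ^ 2 / d ≤ 1 / q := by
      rw [div_le_div_iff₀ hd0 hq0, one_mul]
      calc _ = N := by rw [hN]; ring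
        _ ≤ d := hd
    have h2 : (√(1 + δ * (ε / 2) ^ 2 / 4 * q ^ 2))⁻¹ ≤ 4 / (ε * √δ) / q := by
      rw [inv_le_comm₀ (Real.sqrt_pos.2 (by positivity)) (by positivity)]
      refine Real.le_sqrt_of_sq_le ?_
      have : ((4 / (ε * √δ) / q)⁻¹) ^ 2 = δ * (ε / 2) ^ 2 / 4 * q ^ 2 := by
        rw [inv_pow, div_pow, div_pow, mul_pow, Real.sq_sqrt hδ.le]
        field_simp
        norm_num
      rw [this]
      linarith only
    calc _ ≤ 4 / (ε * √δ) / q + 1 / q := add_le_add h2 h1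
      _ = A := by rw [hA, hC1]; ring
  have hsub : {ω | ¬ ∀ a, min (1 / 8) (1 / (2 * q)) * √S * ‖a‖ ≤ ‖arrayMap ζ w ω a‖} ⊆
      {ω | B * √S < ‖arrayMap ζ w ω‖} ∪
      ({ω | ‖arrayMap ζ w ω‖ ≤ B * √S ∧ ∃ a : EuclideanSpace ℝ V, ‖a‖ = 1 ∧
        ((Finset.univ.filter fun v => ε / √(Fintype.card V) ≤ |a v|).card : ℝ) ≤
          δ * d ∧ ‖arrayMap ζ w ω a‖ < √S / 8} ∪
      {ω | ‖arrayMap ζ w ω‖ ≤ B * √S ∧ ∃ a : EuclideanSpace ℝ V, ‖a‖ = 1 ∧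
        δ * d ≤ ((Finset.univ.filter fun v => ε / √(Fintype.card V) ≤ |a v|).card : ℝ) ∧
          ‖arrayMap ζ w ω a‖ < √S / (2 * q)}) := by
    intro ω hω
    by_contra hcon
    simp only [Set.mem_union, Set.mem_ofPred_eq, not_or, not_lt, not_and, not_exists] at hcon
    obtain ⟨hop, hsp, hsd⟩ := hcon
    refine hω (le_norm_of_unit _ fun a ha => ?_)
    have hsq := Real.sqrt_nonneg S
    rcases le_total ((Finset.univ.filter fun v => ε / √(Fintype.card V) ≤ |a v|).card : ℝ) (δ * d)
      with hle | hle
    · refine le_trans ?_ (hsp hop a ha hle)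
      have := mul_le_mul_of_nonneg_right (min_le_left (1 / 8) (1 / (2 * q))) hsq
      linarith only [this]
    · refine le_trans ?_ (hsd hop a ha hle)
      have := mul_le_mul_of_nonneg_right (min_le_right (1 / 8) (1 / (2 * q))) hsq
      rwa [one_div_mul_eq_div] at this
  refine (measureReal_mono hsub (measure_ne_top _ _)).trans ((measureReal_union_le _ _).trans
    (add_le_add_right (measureReal_union_le _ _) _ |>.trans ?_))
  have h1 := h.measureReal_lt_opNorm_le hc hw0 hw1 (by linarith only [hd2, hd0])
  have h2 := h.measureReal_sparse_le hc hw0 hw1 hε hε2 hεc (δ * d)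
  have h3 := h.measureReal_spread_le hc hw0 hw1 hdpos hε hδ hq0 hq3 hq4 hAle
  have hm1 : min 1 c1 * d ≤ d := by
    have := mul_le_mul_of_nonneg_right (min_le_left 1 c1) hd0.le
    rwa [one_mul] at this
  have hm2 : min 1 c1 * d ≤ c1 * d := mul_le_mul_of_nonneg_right (min_le_right 1 c1) hd0.le
  have hm3 : c1 * (2 * d) ≤ c1 * S := mul_le_mul_of_nonneg_left hd2 hc1'.le
  have e1 : Real.exp (-S) ≤ Real.exp (-min 1 c1 * d) := by
    rw [Real.exp_le_exp, neg_mul]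
    linarith only [hm1, hd2, hd0]
  have e2 : ((latticeBall V (d / ε) (δ * d)).card : ℝ) * Real.exp (-c1 * S) ≤
      Real.exp (-min 1 c1 * d) := by
    calc _ ≤ Real.exp (c1 * d) * Real.exp (-c1 * S) := by
          gcongr
          exact hcard V
      _ ≤ _ := by
          rw [← Real.exp_add, Real.exp_le_exp, neg_mul, neg_mul]
          linarith only [hm2, hm3]
  have e3 : (18 * B * q) ^ Fintype.card V * (E * A) ^ S ≤ Real.exp (-min 1 c1 * d) := by
    have hEA0 : 0 < E * A := by positivity
    have hEA : E * A ≤ 1 := by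
      rw [hA, ← mul_div_assoc, div_le_one hq0]; exact hq2
    -- Here the aspect ratio 2 matters: the probability is of order q^(−2d) against a net of order
    -- q^d, so large q wins.
    have f1 : (E * A) ^ S ≤ ((E * A) ^ 2) ^ Fintype.card V := by
      rw [← pow_mul, ← Real.rpow_natCast]
      exact Real.rpow_le_rpow_of_exponent_ge hEA0 hEA (by push_cast; exact hd2)
    have f2 : 18 * B * q * (E * A) ^ 2 ≤ E⁻¹ := by
      rw [hA, ← one_div, le_div_iff₀ hE0]
      have : 18 * B * q * (E * (C1 / q)) ^ 2 * E = 18 * B * E ^ 3 * C1 ^ 2 / q := by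
        field_simp
      rw [this, div_le_one hq0]
      exact hq1
    calc _ ≤ (18 * B * q) ^ Fintype.card V * ((E * A) ^ 2) ^ Fintype.card V := by gcongr
      _ = (18 * B * q * (E * A) ^ 2) ^ Fintype.card V := by rw [← mul_pow]
      _ ≤ E⁻¹ ^ Fintype.card V := by gcongr
      _ = Real.exp (-d) := by rw [hE, ← Real.exp_neg, ← Real.exp_nat_mul, mul_neg, mul_one]
      _ ≤ _ := by
          rw [Real.exp_le_exp, neg_mul]
          linarith only [hm1]
  linarith only [h1, h2, h3, e1, e2, e3]

/-! ### The orthogonal projection onto the null space of a matrix with independent rows -/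

section NullProj

theorem isUnit_det_of_injective {m n : Type*} [Fintype m] [Fintype n] [DecidableEq m]
    {X : Matrix m n ℝ} (h : ∀ v : m → ℝ, Xᵀ *ᵥ v = 0 → v = 0) :
    IsUnit (X * Xᵀ).det := by
  rw [isUnit_iff_ne_zero]
  intro h0
  obtain ⟨v, hv, hv0⟩ := Matrix.exists_mulVec_eq_zero_iff.2 h0
  refine hv (h v ?_)
  have h1 : v ⬝ᵥ ((X * Xᵀ) *ᵥ v) = (Xᵀ *ᵥ v) ⬝ᵥ (Xᵀ *ᵥ v) := by
    rw [← Matrix.mulVec_mulVec, Matrix.dotProduct_mulVec, ← Matrix.mulVec_transpose]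
  rw [hv0, dotProduct_zero] at h1
  exact dotProduct_self_eq_zero.1 h1.symm

variable {m n : Type*} [Fintype m] [Fintype n] [DecidableEq m] [DecidableEq n]

/-- The orthogonal projection onto the null space of `X`, for `X * Xᵀ` invertible. -/
noncomputable def nullProj (X : Matrix m n ℝ) : Matrix n n ℝ := 1 - Xᵀ * ((X * Xᵀ)⁻¹ * X)

variable {X : Matrix m n ℝ}

theorem transpose_nullProj : (nullProj X)ᵀ = nullProj X := by
  simp [nullProj, Matrix.transpose_nonsing_inv, Matrix.mul_assoc]

theorem nullProj_apply_comm (i j : n) : nullProj X i j = nullProj X j i :=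
  congrFun (congrFun (transpose_nullProj (X := X)) j) i

theorem nullProj_mul_transpose (hX : IsUnit (X * Xᵀ).det) : nullProj X * Xᵀ = 0 := by
  rw [nullProj, Matrix.sub_mul, Matrix.one_mul, Matrix.mul_assoc, Matrix.mul_assoc,
    Matrix.nonsing_inv_mul _ hX, Matrix.mul_one, sub_self]

theorem nullProj_mul_self (hX : IsUnit (X * Xᵀ).det) :
    nullProj X * nullProj X = nullProj X := by
  conv_lhs => rw [nullProj.eq_def (X := X)]
  rw [← nullProj, nullProj.eq_def, Matrix.mul_sub, ← nullProj, ← Matrix.mul_assoc,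
    nullProj_mul_transpose hX, Matrix.zero_mul, Matrix.mul_one, sub_zero]

theorem sum_nullProj_sq (hX : IsUnit (X * Xᵀ).det) (i : n) :
    ∑ j, nullProj X i j ^ 2 = nullProj X i i := by
  conv_rhs => rw [← nullProj_mul_self hX, Matrix.mul_apply]
  exact Finset.sum_congr rfl fun j _ => by rw [nullProj_apply_comm j i, sq]

theorem nullProj_diag_le_one (hX : IsUnit (X * Xᵀ).det) (i : n) : nullProj X i i ≤ 1 := by
  have h1 := sum_nullProj_sq hX i
  have h2 := Finset.single_le_sum (f := fun j => nullProj X i j ^ 2) (fun _ _ => sq_nonneg _)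
    (Finset.mem_univ i)
  rw [h1] at h2
  nlinarith

/-- Cauchy–Schwarz against row i, whose squared norm is the diagonal entry because the projection is
symmetric and idempotent. -/
theorem nullProj_mulVec_sq_le (hX : IsUnit (X * Xᵀ).det) (θ : n → ℝ) (i : n) :
    (nullProj X *ᵥ θ) i ^ 2 ≤ nullProj X i i * ∑ j, θ j ^ 2 := by
  rw [← sum_nullProj_sq hX i]
  exact Finset.sum_mul_sq_le_sq_mul_sq Finset.univ (fun j => nullProj X i j) θ

theorem sum_nullProj_mulVec_sq (hX : IsUnit (X * Xᵀ).det) (u : n → ℝ) :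
    ∑ i, (nullProj X *ᵥ u) i ^ 2 = u ⬝ᵥ (nullProj X *ᵥ u) := by
  have h : ∑ i, (nullProj X *ᵥ u) i ^ 2 = (nullProj X *ᵥ u) ⬝ᵥ (nullProj X *ᵥ u) :=
    Finset.sum_congr rfl fun i _ => by rw [sq]
  rw [h, Matrix.dotProduct_mulVec, ← Matrix.mulVec_transpose, transpose_nullProj,
    Matrix.mulVec_mulVec, nullProj_mul_self hX, dotProduct_comm]

theorem sum_nullProj_mulVec_sq_le (hX : IsUnit (X * Xᵀ).det) (u : n → ℝ) :
    ∑ i, (nullProj X *ᵥ u) i ^ 2 ≤ ∑ i, u i ^ 2 := by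
  have h1 := sum_nullProj_mulVec_sq hX u
  have h2 : 0 ≤ ∑ i, (u i - (nullProj X *ᵥ u) i) ^ 2 := Finset.sum_nonneg fun _ _ => sq_nonneg _
  have h3 : ∑ i, (u i - (nullProj X *ᵥ u) i) ^ 2 =
      ∑ i, u i ^ 2 - 2 * (u ⬝ᵥ (nullProj X *ᵥ u)) + ∑ i, (nullProj X *ᵥ u) i ^ 2 := by
    simp only [dotProduct, Finset.mul_sum, ← Finset.sum_add_distrib, ← Finset.sum_sub_distrib]
    exact Finset.sum_congr rfl fun i _ => by ring
  linarith

theorem nullProj_mulVec_single (j : n) (i : n) :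
    (nullProj X *ᵥ Pi.single j 1) i = nullProj X i j := by
  simp

/-- The diagonal entry is the squared distance from the basis vector to the row space. -/
theorem nullProj_diag_le (hX : IsUnit (X * Xᵀ).det) (j : n) (a : m → ℝ) :
    nullProj X j j ≤ ∑ i, ((Pi.single j 1 : n → ℝ) i - (Xᵀ *ᵥ a) i) ^ 2 := by
  have h1 := sum_nullProj_mulVec_sq_le hX (Pi.single j 1 - Xᵀ *ᵥ a)
  have h2 : nullProj X *ᵥ (Pi.single j 1 - Xᵀ *ᵥ a) = nullProj X *ᵥ Pi.single j 1 := by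
    rw [Matrix.mulVec_sub, Matrix.mulVec_mulVec, nullProj_mul_transpose hX, Matrix.zero_mulVec,
      sub_zero]
  rw [h2] at h1
  rw [← sum_nullProj_sq hX j]
  refine le_trans (le_of_eq (Finset.sum_congr rfl fun i _ => ?_)) h1
  rw [nullProj_mulVec_single, nullProj_apply_comm]

/-- The distance is attained at the regression coefficients (XXᵀ)⁻¹X e_j, so a lower bound valid for
all a transfers to the diagonal entry. -/
theorem exists_nullProj_diag_eq (hX : IsUnit (X * Xᵀ).det) (j : n) :
    ∃ a : m → ℝ, nullProj X j j = ∑ i, ((Pi.single j 1 : n → ℝ) i - (Xᵀ *ᵥ a) i) ^ 2 := by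
  refine ⟨((X * Xᵀ)⁻¹ * X) *ᵥ Pi.single j 1, ?_⟩
  rw [← sum_nullProj_sq hX j]
  refine Finset.sum_congr rfl fun i _ => ?_
  rw [nullProj_apply_comm, ← nullProj_mulVec_single, nullProj, Matrix.sub_mulVec, Matrix.one_mulVec,
    Matrix.mulVec_mulVec]
  rfl

end NullProj

/-! ### The bias through the diagonal of the null projection -/

theorem sub_minNormInterpolator {n p : ℕ} (X : Matrix (Fin n) (Fin p) ℝ) (θ : Fin p → ℝ) :
    θ - minNormInterpolator X (X *ᵥ θ) = nullProj X *ᵥ θ := by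
  rw [minNormInterpolator, nullProj, Matrix.sub_mulVec, Matrix.one_mulVec, Matrix.mulVec_mulVec,
    Matrix.mulVec_mulVec, Matrix.mul_assoc]

theorem bias_eq_sum {n p : ℕ} (lamT : Fin p → ℝ) (X : Matrix (Fin n) (Fin p) ℝ) (θ : Fin p → ℝ) :
    bias lamT X θ = ∑ i, lamT i * (nullProj X *ᵥ θ) i ^ 2 := by
  rw [bias, sub_minNormInterpolator, dotProduct]
  refine Finset.sum_congr rfl fun i _ => ?_
  rw [Matrix.mulVec_diagonal]
  ring

theorem bias_le {n p : ℕ} {lamT : Fin p → ℝ} (hT : ∀ i, 0 ≤ lamT i)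
    {X : Matrix (Fin n) (Fin p) ℝ} (hX : IsUnit (X * Xᵀ).det) (θ : Fin p → ℝ) :
    bias lamT X θ ≤ (∑ i, θ i ^ 2) * ∑ i, lamT i * nullProj X i i := by
  rw [bias_eq_sum, Finset.mul_sum]
  refine Finset.sum_le_sum fun i _ => ?_
  have := mul_le_mul_of_nonneg_left (nullProj_mulVec_sq_le hX θ i) (hT i)
  linarith

/-- Averaging over random signs keeps at least the diagonal part of a squared sum. -/
theorem sum_signs_sq_ge {p : ℕ} (b : Fin p → ℝ) (j : Fin p) :
    2 ^ p * b j ^ 2 ≤ ∑ γ : Fin p → ℤˣ, (∑ i, b i * ((γ i : ℤ) : ℝ)) ^ 2 := by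
  set f : (Fin p → ℤˣ) → ℝ := fun γ => (∑ i, b i * ((γ i : ℤ) : ℝ)) ^ 2 with hf
  -- Multiplying by `s` flips every sign except the j-th. Pairing γ with γ * s gives (u + y)² + (u −
  -- y)² ≥ 2u², with u the j-th term.
  set s : Fin p → ℤˣ := fun i => if i = j then 1 else -1 with hs
  have h1 : ∑ γ, f (γ * s) = ∑ γ, f γ := Equiv.sum_comp (Equiv.mulRight s) f
  have h2 : ∀ γ : Fin p → ℤˣ, 2 * b j ^ 2 ≤ f γ + f (γ * s) := fun γ => by
    have hsq : ((γ j : ℤ) : ℝ) ^ 2 = 1 := by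
      rcases Int.units_eq_one_or (γ j) with h | h <;> simp [h]
    have e1 : ∑ i, b i * ((γ i : ℤ) : ℝ) =
        b j * ((γ j : ℤ) : ℝ) + ∑ i ∈ Finset.univ.erase j, b i * ((γ i : ℤ) : ℝ) :=
      (Finset.add_sum_erase _ _ (Finset.mem_univ j)).symm
    have e2 : ∑ i, b i * (((γ * s) i : ℤ) : ℝ) =
        b j * ((γ j : ℤ) : ℝ) - ∑ i ∈ Finset.univ.erase j, b i * ((γ i : ℤ) : ℝ) := by
      rw [← Finset.add_sum_erase _ _ (Finset.mem_univ j), sub_eq_add_neg,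
        ← Finset.sum_neg_distrib]
      congr 1
      · simp [hs]
      · refine Finset.sum_congr rfl fun i hi => ?_
        simp [hs, Finset.ne_of_mem_erase hi]
    simp only [hf]
    rw [e1, e2]
    set y := ∑ i ∈ Finset.univ.erase j, b i * ((γ i : ℤ) : ℝ)
    have : (b j * ((γ j : ℤ) : ℝ)) ^ 2 = b j ^ 2 := by rw [mul_pow, hsq, mul_one]
    nlinarith [sq_nonneg y]
  have h3 := Finset.sum_le_sum fun γ (_ : γ ∈ (Finset.univ : Finset (Fin p → ℤˣ))) => h2 γ
  rw [Finset.sum_add_distrib, h1, Finset.sum_const, Finset.card_univ] at h3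
  simp only [Fintype.card_pi, Fintype.card_units_int, Finset.prod_const, Finset.card_univ,
    Fintype.card_fin, nsmul_eq_mul] at h3
  push_cast at h3
  linarith

/-- In coordinate j only the contribution of P_jj θ_j survives. This is the origin of the squared
denominators in the lower bound. -/
theorem le_expectedBias {n p : ℕ} {lamT : Fin p → ℝ} (hT : ∀ i, 0 ≤ lamT i)
    (X : Matrix (Fin n) (Fin p) ℝ) (θ : Fin p → ℝ) :
    ∑ j, lamT j * θ j ^ 2 * nullProj X j j ^ 2 ≤ expectedBias lamT X θ := by
  rw [expectedBias, le_div_iff₀ (by positivity)]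
  simp_rw [bias_eq_sum]
  rw [Finset.sum_comm, Finset.sum_mul]
  refine Finset.sum_le_sum fun j _ => ?_
  rw [← Finset.mul_sum]
  have h := sum_signs_sq_ge (fun i => nullProj X j i * θ i) j
  have h2 : ∀ γ : Fin p → ℤˣ, (nullProj X *ᵥ fun i => ((γ i : ℤ) : ℝ) * θ i) j =
      ∑ i, nullProj X j i * θ i * ((γ i : ℤ) : ℝ) := fun γ => by
    rw [Matrix.mulVec, dotProduct]
    exact Finset.sum_congr rfl fun i _ => by ring
  simp_rw [h2]
  have := mul_le_mul_of_nonneg_left h (hT j)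
  refine le_trans (le_of_eq ?_) this
  ring

/-- A lower bound for a diagonal entry from a lower bound for the remaining columns. -/
theorem le_nullProj_diag {m n : Type*} [Fintype m] [Fintype n] [DecidableEq m] [DecidableEq n]
    {X : Matrix m n ℝ} (hX : IsUnit (X * Xᵀ).det) (j : n) (T : Finset n) (hj : j ∉ T) {A B : ℝ}
    (hA : 0 < A) (hB : 0 < B) (hT : ∀ a : m → ℝ, B * ∑ r, a r ^ 2 ≤ ∑ i ∈ T, (Xᵀ *ᵥ a) i ^ 2)
    (hcol : ∑ r, X r j ^ 2 ≤ A) : 1 / (1 + A / B) ≤ nullProj X j j := by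
  obtain ⟨a, ha⟩ := exists_nullProj_diag_eq hX j
  rw [ha]
  set y := (Xᵀ *ᵥ a) j with hy
  have h1 : (1 - y) ^ 2 + ∑ i ∈ T, (Xᵀ *ᵥ a) i ^ 2 ≤
      ∑ i, ((Pi.single j 1 : n → ℝ) i - (Xᵀ *ᵥ a) i) ^ 2 := by
    calc _ = ∑ i ∈ insert j T, ((Pi.single j 1 : n → ℝ) i - (Xᵀ *ᵥ a) i) ^ 2 := by
          rw [Finset.sum_insert hj, Pi.single_eq_same]
          congr 1
          refine Finset.sum_congr rfl fun i hi => ?_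
          have hij : i ≠ j := fun h => hj (h ▸ hi)
          rw [Pi.single_eq_of_ne hij]
          ring
      _ ≤ _ := Finset.sum_le_sum_of_subset_of_nonneg (Finset.subset_univ _)
          fun _ _ _ => sq_nonneg _
  have h2 : y ^ 2 ≤ A * ∑ r, a r ^ 2 := by
    have h3 := Finset.sum_mul_sq_le_sq_mul_sq Finset.univ (fun r => X r j) a
    have h4 : y = ∑ r, X r j * a r := rfl
    rw [h4]
    refine h3.trans ?_
    have : 0 ≤ ∑ r, a r ^ 2 := Finset.sum_nonneg fun _ _ => sq_nonneg _
    gcongr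
  have h5 := hT a
  set s := ∑ r, a r ^ 2
  refine le_trans ?_ h1
  have h6 : 1 / (1 + A / B) = B / (A + B) := by field_simp; ring_nf
  rw [h6, div_le_iff₀ (by positivity)]
  -- What remains is to minimize (1 − y)² + (B/A)y². The minimum B/(A + B) is attained at y = A/(A +
  -- B).
  have h7 : B * y ^ 2 ≤ A * (B * s) := by nlinarith
  have h8 : A * (B * s) ≤ A * ∑ i ∈ T, (Xᵀ *ᵥ a) i ^ 2 := by gcongr
  have h9 : 0 ≤ ∑ i ∈ T, (Xᵀ *ᵥ a) i ^ 2 := Finset.sum_nonneg fun _ _ => sq_nonneg _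
  have h10 : 0 ≤ B * ∑ i ∈ T, (Xᵀ *ᵥ a) i ^ 2 := by positivity
  nlinarith [sq_nonneg ((A + B) * y - A), mul_pos hA hB,
    sq_nonneg (A * (1 - y) - B * y)]

/-- An upper bound for a diagonal entry in the head of the spectrum. -/
theorem nullProj_diag_le_of_head {m n : Type*} [Fintype m] [Fintype n] [DecidableEq m]
    [DecidableEq n] {X : Matrix m n ℝ} (hX : IsUnit (X * Xᵀ).det) (lam : n → ℝ)
    (hlam : ∀ i, 0 < lam i) (H : n → Prop) [DecidablePred H] {τ K : ℝ} (hτ : 0 < τ) (hK : 0 ≤ K)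
    (hhead : ∀ u : {i // H i} → ℝ,
      τ * ∑ i, u i ^ 2 ≤ ∑ r, (∑ i : {i // H i}, u i * (X r i / √(lam i))) ^ 2)
    (htail : ∀ a : m → ℝ,
      ∑ i ∈ Finset.univ.filter fun i => ¬ H i, (Xᵀ *ᵥ a) i ^ 2 ≤ K * ∑ r, a r ^ 2)
    (j : n) (hj : H j) : nullProj X j j ≤ K / (τ * lam j) := by
  set Y : Matrix {i // H i} m ℝ := Matrix.of fun i r => X r i / √(lam i) with hY
  have hYu : ∀ u r, (Yᵀ *ᵥ u) r = ∑ i : {i // H i}, u i * (X r i / √(lam i)) := fun u r =>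
    Finset.sum_congr rfl fun i _ => by simp [hY, mul_comm]
  have hhead' : ∀ u, τ * ∑ i, u i ^ 2 ≤ ∑ r, (Yᵀ *ᵥ u) r ^ 2 := fun u => by
    simp_rw [hYu]; exact hhead u
  have hunit : IsUnit (Y * Yᵀ).det := isUnit_det_of_injective fun u hu => by
    have h1 := hhead' u
    rw [hu] at h1
    simp only [Pi.zero_apply, ne_eq, OfNat.ofNat_ne_zero, not_false_eq_true, zero_pow,
      Finset.sum_const_zero] at h1
    have h2 : ∑ i, u i ^ 2 = 0 := le_antisymm (by nlinarith)
      (Finset.sum_nonneg fun _ _ => sq_nonneg _)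
    funext i
    have := (Finset.sum_eq_zero_iff_of_nonneg fun i _ => sq_nonneg (u i)).1 h2 i (Finset.mem_univ i)
    simpa using this
  set jj : {i // H i} := ⟨j, hj⟩ with hjj
  -- Yᵀu is the least-norm solution of Yv = e_j for the whitened head Y, and its squared norm is the
  -- diagonal entry u_j of (YYᵀ)⁻¹. Divided by √λ_j, it gives a vector a for which Xᵀa agrees with
  -- e_j on the head.
  set u : {i // H i} → ℝ := (Y * Yᵀ)⁻¹ *ᵥ Pi.single jj 1 with hu
  have hsol : Y *ᵥ (Yᵀ *ᵥ u) = Pi.single jj 1 := by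
    rw [Matrix.mulVec_mulVec, hu, Matrix.mulVec_mulVec, Matrix.mul_nonsing_inv _ hunit,
      Matrix.one_mulVec]
  have hnorm : ∑ r, (Yᵀ *ᵥ u) r ^ 2 = u jj := by
    have h1 : ∑ r, (Yᵀ *ᵥ u) r ^ 2 = (Yᵀ *ᵥ u) ⬝ᵥ (Yᵀ *ᵥ u) :=
      Finset.sum_congr rfl fun r _ => sq _
    rw [h1, Matrix.dotProduct_mulVec, ← Matrix.mulVec_transpose, Matrix.transpose_transpose, hsol]
    simp
  -- The frame bound and ‖Yᵀu‖² = u_j give τu_j² ≤ u_j.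
  have huj : u jj ≤ 1 / τ := by
    have h1 := hhead' u
    rw [hnorm] at h1
    have h2 := Finset.single_le_sum (f := fun i => u i ^ 2) (fun _ _ => sq_nonneg _)
      (Finset.mem_univ jj)
    have h3 : τ * u jj ^ 2 ≤ u jj := (mul_le_mul_of_nonneg_left h2 hτ.le).trans h1
    rw [le_div_iff₀ hτ]
    by_contra hcon
    push Not at hcon
    have h4 : 0 < u jj := by nlinarith
    nlinarith
  have hs := Real.sqrt_pos.2 (hlam j)
  set a : m → ℝ := fun r => (Yᵀ *ᵥ u) r / √(lam j) with ha
  have hasq : ∑ r, a r ^ 2 ≤ 1 / (τ * lam j) := by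
    have h1 : ∑ r, a r ^ 2 = u jj / lam j := by
      rw [← hnorm, Finset.sum_div]
      refine Finset.sum_congr rfl fun r _ => ?_
      rw [ha, div_pow, Real.sq_sqrt (hlam j).le]
    rw [h1, ← div_div]
    exact div_le_div_of_nonneg_right huj (hlam j).le
  have hXa : ∀ i (hi : H i), (Xᵀ *ᵥ a) i = (Pi.single j 1 : n → ℝ) i := fun i hi => by
    have h1 := congrFun hsol ⟨i, hi⟩
    have h2 : (Y *ᵥ (Yᵀ *ᵥ u)) ⟨i, hi⟩ = (Xᵀ *ᵥ a) i * (√(lam j) / √(lam i)) := by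
      rw [Matrix.mulVec, Matrix.mulVec, dotProduct, dotProduct, Finset.sum_mul]
      refine Finset.sum_congr rfl fun r _ => ?_
      simp only [hY, ha, Matrix.of_apply, Matrix.transpose_apply]
      have := Real.sqrt_pos.2 (hlam i)
      field_simp
    rw [h2] at h1
    by_cases hij : i = j
    · subst hij
      rw [div_self hs.ne', mul_one] at h1
      rw [h1, hjj]
      simp
    · have h3 : (⟨i, hi⟩ : {i // H i}) ≠ jj := fun h => hij (congrArg Subtype.val h)
      rw [Pi.single_eq_of_ne h3] at h1
      have := Real.sqrt_pos.2 (hlam i)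
      rw [Pi.single_eq_of_ne hij]
      exact (mul_eq_zero.1 h1).resolve_right (by positivity)
  refine (nullProj_diag_le hX j a).trans ?_
  rw [← Finset.sum_filter_add_sum_filter_not Finset.univ H]
  have h0 : ∑ i ∈ Finset.univ.filter H, ((Pi.single j 1 : n → ℝ) i - (Xᵀ *ᵥ a) i) ^ 2 = 0 :=
    Finset.sum_eq_zero fun i hi => by
      rw [hXa i (Finset.mem_filter.1 hi).2, sub_self]; norm_num
  have h1 : ∑ i ∈ Finset.univ.filter fun i => ¬ H i,
      ((Pi.single j 1 : n → ℝ) i - (Xᵀ *ᵥ a) i) ^ 2 =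
      ∑ i ∈ Finset.univ.filter fun i => ¬ H i, (Xᵀ *ᵥ a) i ^ 2 :=
    Finset.sum_congr rfl fun i hi => by
      have hij : i ≠ j := fun h => (Finset.mem_filter.1 hi).2 (h ▸ hj)
      rw [Pi.single_eq_of_ne hij, zero_sub, neg_sq]
  rw [h0, h1, zero_add]
  refine (htail a).trans ((mul_le_mul_of_nonneg_left hasq hK).trans (le_of_eq ?_))
  rw [mul_one_div]

/-! ### The whitened data matrix -/

theorem iIndepFun_comp_measurePreserving {Ω Ω' ι β : Type*} [MeasurableSpace Ω]
    [MeasurableSpace Ω'] [MeasurableSpace β] [Fintype ι] {μ : Measure Ω} {ν : Measure Ω'}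
    {f : ι → Ω' → β} {g : Ω → Ω'} (hg : MeasurePreserving g μ ν) (hf : ∀ i, Measurable (f i))
    (h : iIndepFun f ν) : iIndepFun (fun i ω => f i (g ω)) μ := by
  have := h.isProbabilityMeasure
  have : IsProbabilityMeasure μ := by
    constructor
    rw [← Set.preimage_univ (f := g), hg.measure_preimage MeasurableSet.univ.nullMeasurableSet,
      measure_univ]
  have hm := hg.measurable
  refine (iIndepFun_iff_map_fun_eq_pi_map (f := fun i ω => f i (g ω))
    fun i => ((hf i).comp hm).aemeasurable).2 ?_
  have h1 : ∀ i, μ.map (fun ω => f i (g ω)) = ν.map (f i) := fun i => by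
    rw [← hg.map_eq, Measure.map_map (hf i) hm]; rfl
  simp_rw [h1]
  rw [← h.map_fun_eq_pi_map fun i => (hf i).aemeasurable, ← hg.map_eq,
    Measure.map_map (by fun_prop) hm]
  rfl

/-- The entries of the whitened data matrix. -/
noncomputable def whitened {n p : ℕ} (lam : Fin p → ℝ) (r : Fin n) (i : Fin p)
    (X : Fin n → Fin p → ℝ) : ℝ := X r i / √(lam i)

/-- The square of the subgaussian parameter, as a nonnegative real number. -/
noncomputable def sqParam (σ : ℝ) : NNReal := ⟨σ ^ 2, sq_nonneg σ⟩

section Law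

variable {n p : ℕ} {D : Measure (Fin p → ℝ)} {lam : Fin p → ℝ} {σ : ℝ}

theorem IsSourceLaw.isProbabilityMeasure_sampleLaw (hD : IsSourceLaw D lam σ) (n : ℕ) :
    IsProbabilityMeasure (sampleLaw n D) := by
  have := hD.isProbabilityMeasure
  unfold sampleLaw
  infer_instance

/-- Independence within a row comes from the source law and across rows from the product measure.
Taking γ = s e_i turns the vector moment bound into the scalar one. -/
theorem IsSourceLaw.isSubgaussianArray (hD : IsSourceLaw D lam σ) (n : ℕ) :
    IsSubgaussianArray (whitened (n := n) lam) (sqParam σ) (sampleLaw n D) := by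
  have := hD.isProbabilityMeasure
  have hev : ∀ r : Fin n, MeasurePreserving (fun X : Fin n → Fin p → ℝ => X r)
      (sampleLaw n D) D := fun r => measurePreserving_eval (fun _ => D) r
  have hint : ∀ (r : Fin n) (f : (Fin p → ℝ) → ℝ), Measurable f →
      ∫ X, f (X r) ∂(sampleLaw n D) = ∫ x, f x ∂D := fun r f hf => by
    have h := integral_map (μ := sampleLaw n D) (hev r).measurable.aemeasurable
      (f := f) hf.aestronglyMeasurable
    rw [(hev r).map_eq] at h
    exact h.symm
  have hexp : ∀ (i : Fin p) (s : ℝ) (x : Fin p → ℝ),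
      ∑ l, (Pi.single i s : Fin p → ℝ) l * (x l / √(lam l)) = s * (x i / √(lam i)) :=
    fun i s x => by
      rw [Finset.sum_eq_single i (fun l _ hl => by rw [Pi.single_eq_of_ne hl, zero_mul])
        (fun h => absurd (Finset.mem_univ i) h), Pi.single_eq_same]
  refine ⟨fun r i => ?_, ?_, fun r i => ?_, fun r i => ?_, fun r i => ⟨fun s => ?_, fun s => ?_⟩⟩
  · unfold whitened
    fun_prop
  · refine iIndepFun_uncurry' (X := fun r i X => whitened (n := n) lam r i X) (fun r i => ?_) ?_
      fun r => ?_
    · unfold whitened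
      fun_prop
    · exact iIndepFun_pi (X := fun (_ : Fin n) (x : Fin p → ℝ) (i : Fin p) => x i / √(lam i))
        fun r => Measurable.aemeasurable (by fun_prop)
    · exact iIndepFun_comp_measurePreserving (f := fun i (x : Fin p → ℝ) => x i / √(lam i))
        (g := fun X : Fin n → Fin p → ℝ => X r) (hev r) (fun i => by fun_prop) hD.indep
  · refine (hint r (fun x => x i / √(lam i)) (by fun_prop)).trans ?_
    rw [integral_div, hD.centered, zero_div]
  · refine (hint r (fun x => (x i / √(lam i)) ^ 2) (by fun_prop)).trans ?_
    have h1 : ∀ x : Fin p → ℝ, (x i / √(lam i)) ^ 2 = x i * x i / lam i := fun x => by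
      rw [div_pow, Real.sq_sqrt (hD.pos i).le, sq]
    simp_rw [h1]
    rw [integral_div, hD.covariance, Matrix.diagonal_apply_eq, div_self (hD.pos i).ne']
  · have h1 := (hD.subgaussian (Pi.single i s)).1
    simp_rw [hexp] at h1
    exact (hev r).integrable_comp_of_integrable h1
  · have h1 := (hD.subgaussian (Pi.single i s)).2
    simp_rw [hexp] at h1
    have h2 : ∑ l, (Pi.single i s : Fin p → ℝ) l ^ 2 = s ^ 2 := by
      rw [Finset.sum_eq_single i (fun l _ hl => by rw [Pi.single_eq_of_ne hl]; norm_num)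
        (fun h => absurd (Finset.mem_univ i) h), Pi.single_eq_same]
    rw [h2] at h1
    refine (le_of_eq (hint r (fun x => Real.exp (s * (x i / √(lam i)))) (by fun_prop))).trans ?_
    exact h1

/-- The weights that select the columns in `T`. -/
noncomputable def tailWeight (lam : Fin p → ℝ) (T : Finset (Fin p)) (Λ : ℝ) (i : Fin p) : ℝ :=
  if i ∈ T then lam i / Λ else 0

theorem tailWeight_nonneg (hlam : ∀ i, 0 < lam i) (T : Finset (Fin p)) {Λ : ℝ} (hΛ : 0 < Λ)
    (i : Fin p) : 0 ≤ tailWeight lam T Λ i := by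
  have := hlam i
  unfold tailWeight
  split_ifs <;> positivity

theorem tailWeight_le_one {T : Finset (Fin p)} {Λ : ℝ} (hΛ : 0 < Λ) (hT : ∀ i ∈ T, lam i ≤ Λ)
    (i : Fin p) : tailWeight lam T Λ i ≤ 1 := by
  unfold tailWeight
  split_ifs with h
  · exact (div_le_one hΛ).2 (hT i h)
  · exact zero_le_one

theorem sum_tailWeight (T : Finset (Fin p)) (Λ : ℝ) :
    ∑ i, tailWeight lam T Λ i = (∑ i ∈ T, lam i) / Λ := by
  unfold tailWeight
  rw [Finset.sum_ite_mem, Finset.univ_inter, Finset.sum_div]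

/-- The weight λ_i/Λ undoes the whitening up to one common factor: √(λ_i/Λ) z_i = x_i/√Λ. -/
theorem norm_arrayMap_whitened_sq (hlam : ∀ i, 0 < lam i) (T : Finset (Fin p)) {Λ : ℝ}
    (hΛ : 0 < Λ) (X : Fin n → Fin p → ℝ) (a : Fin n → ℝ) :
    ‖arrayMap (whitened lam) (tailWeight lam T Λ) X (WithLp.toLp 2 a)‖ ^ 2 =
      (∑ i ∈ T, ((Matrix.of X)ᵀ *ᵥ a) i ^ 2) / Λ := by
  rw [norm_arrayMap_sq _ (tailWeight_nonneg hlam T hΛ), quadForm]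
  unfold tailWeight
  simp_rw [ite_mul, zero_mul]
  rw [Finset.sum_ite_mem, Finset.univ_inter, Finset.sum_div]
  refine Finset.sum_congr rfl fun i _ => ?_
  have h1 : colSum (whitened lam) (WithLp.toLp 2 a) i X =
      ((Matrix.of X)ᵀ *ᵥ a) i / √(lam i) := by
    rw [colSum, Matrix.mulVec, dotProduct, Finset.sum_div]
    refine Finset.sum_congr rfl fun r _ => ?_
    simp only [whitened, Matrix.transpose_apply, Matrix.of_apply]
    ring
  have := hlam i
  rw [h1, div_pow, Real.sq_sqrt this.le]
  field_simp

/-- The tail columns have a lower frame bound of the order of the sum of the tail. -/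
def TailLower (κ : ℝ) (lam : Fin p → ℝ) (T : Finset (Fin p)) (X : Fin n → Fin p → ℝ) : Prop :=
  ∀ a : Fin n → ℝ, κ * (∑ i ∈ T, lam i) * ∑ r, a r ^ 2 ≤ ∑ i ∈ T, ((Matrix.of X)ᵀ *ᵥ a) i ^ 2

/-- The tail columns have an upper frame bound of the order of the sum of the tail. -/
def TailUpper (K : ℝ) (lam : Fin p → ℝ) (T : Finset (Fin p)) (X : Fin n → Fin p → ℝ) : Prop :=
  ∀ a : Fin n → ℝ, ∑ i ∈ T, ((Matrix.of X)ᵀ *ᵥ a) i ^ 2 ≤ K * (∑ i ∈ T, lam i) * ∑ r, a r ^ 2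

/-- The whitened columns before `k` have a lower frame bound of order `n`. -/
def HeadLower (lam : Fin p → ℝ) (k : Fin p) (X : Fin n → Fin p → ℝ) : Prop :=
  ∀ u : {i // i < k} → ℝ, (n : ℝ) / 64 * ∑ i, u i ^ 2 ≤
    ∑ r, (∑ i : {i // i < k}, u i * (X r i / √(lam i))) ^ 2

theorem sampleLaw_not_tailUpper_le (hD : IsSourceLaw D lam σ) (hσ : 0 < σ) {T : Finset (Fin p)}
    {Λ : ℝ} (hΛ : 0 < Λ) (hT : ∀ i ∈ T, lam i ≤ Λ) (hS : n * Λ ≤ ∑ i ∈ T, lam i) :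
    (sampleLaw n D).real {X | ¬ TailUpper (80 * σ ^ 2) lam T X} ≤ Real.exp (-n) := by
  have := hD.isProbabilityMeasure_sampleLaw n
  have hc : 0 < sqParam σ := by
    rw [← NNReal.coe_pos]; exact sq_pos_of_pos hσ
  have hSn : (n : ℝ) ≤ (∑ i ∈ T, lam i) / Λ := by rwa [le_div_iff₀ hΛ]
  have h1 := (hD.isSubgaussianArray n).measureReal_lt_opNorm_le hc
    (tailWeight_nonneg hD.pos T hΛ) (tailWeight_le_one hΛ hT)
    (by rw [sum_tailWeight, Fintype.card_fin]; exact hSn)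
  rw [sum_tailWeight] at h1
  refine (measureReal_mono (fun X hX => ?_) (measure_ne_top _ _)).trans
    (h1.trans (Real.exp_le_exp.2 (neg_le_neg hSn)))
  by_contra hcon
  simp only [Set.mem_ofPred_eq, not_lt] at hcon
  refine hX fun a => ?_
  set L := arrayMap (whitened lam) (tailWeight lam T Λ) X
  have h2 : ‖L (WithLp.toLp 2 a)‖ ≤
      √(80 * sqParam σ) * √((∑ i ∈ T, lam i) / Λ) * ‖(WithLp.toLp 2 a : EuclideanSpace ℝ (Fin n))‖ :=
    (L.le_opNorm _).trans (by gcongr)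
  have h3 := pow_le_pow_left₀ (norm_nonneg _) h2 2
  have hS0 : 0 ≤ (∑ i ∈ T, lam i) / Λ := (Nat.cast_nonneg n).trans hSn
  have e1 : ((sqParam σ : NNReal) : ℝ) = σ ^ 2 := rfl
  rw [norm_arrayMap_whitened_sq hD.pos T hΛ, mul_pow, mul_pow, Real.sq_sqrt (by positivity),
    Real.sq_sqrt hS0, EuclideanSpace.real_norm_sq_eq, e1, div_le_iff₀ hΛ] at h3
  refine h3.trans (le_of_eq ?_)
  field_simp

/-- The index set is left free because the bound is needed both for the full tail, where it yields
invertibility of XXᵀ, and for the tail without one column j, where it bounds P_jj from below. -/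
theorem exists_sampleLaw_not_tailLower_le (hσ : 0 < σ) :
    ∃ κ r N : ℝ, 0 < κ ∧ 0 < r ∧ 0 < N ∧ ∀ (n p : ℕ) (D : Measure (Fin p → ℝ)) (lam : Fin p → ℝ),
      IsSourceLaw D lam σ → N ≤ n → ∀ (T : Finset (Fin p)) (Λ : ℝ), 0 < Λ →
      (∀ i ∈ T, lam i ≤ Λ) → 2 * (n * Λ) ≤ ∑ i ∈ T, lam i →
      (sampleLaw n D).real {X | ¬ TailLower κ lam T X} ≤ 3 * Real.exp (-r * n) := by
  have hc : 0 < sqParam σ := by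
    rw [← NNReal.coe_pos]; exact sq_pos_of_pos hσ
  obtain ⟨κ, r, N, hκ, hr, hN, H⟩ := exists_wide_lower_bound hc
  refine ⟨κ ^ 2, r, N, by positivity, hr, hN, fun n p D lam hD hn T Λ hΛ hT hS => ?_⟩
  have := hD.isProbabilityMeasure_sampleLaw n
  have hSn : 2 * (n : ℝ) ≤ (∑ i ∈ T, lam i) / Λ := by rw [le_div_iff₀ hΛ]; linarith
  have hS0 : 0 ≤ (∑ i ∈ T, lam i) / Λ := by
    have : (0 : ℝ) ≤ n := Nat.cast_nonneg n
    linarith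
  have h1 := H _ _ _ _ _ _ (hD.isSubgaussianArray n) (tailWeight_nonneg hD.pos T hΛ)
    (tailWeight_le_one hΛ hT) (by rw [Fintype.card_fin]; exact hn)
    (by rw [sum_tailWeight, Fintype.card_fin]; exact hSn)
  rw [sum_tailWeight, Fintype.card_fin] at h1
  refine (measureReal_mono (fun X hX => ?_) (measure_ne_top _ _)).trans h1
  intro hcon
  refine hX fun a => ?_
  have h2 := hcon (WithLp.toLp 2 a)
  have h3 := pow_le_pow_left₀ (by positivity) h2 2
  rw [norm_arrayMap_whitened_sq hD.pos T hΛ, mul_pow, mul_pow, Real.sq_sqrt hS0,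
    EuclideanSpace.real_norm_sq_eq, le_div_iff₀ hΛ] at h3
  refine le_trans (le_of_eq ?_) h3
  field_simp

/-- The array is transposed here: the head coordinates are the short side, and the n samples, with
weight one, are the long side. The factor 1/64 is the square of 1/8. -/
theorem exists_sampleLaw_not_headLower_le (hσ : 0 < σ) :
    ∃ C r : ℝ, 1 ≤ C ∧ 0 < r ∧ ∀ (n p : ℕ) (D : Measure (Fin p → ℝ)) (lam : Fin p → ℝ),
      IsSourceLaw D lam σ → ∀ k : Fin p, C * (k : ℕ) ≤ n →
      (sampleLaw n D).real {X | ¬ HeadLower lam k X} ≤ 2 * Real.exp (-r * n) := by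
  have hc : 0 < sqParam σ := by
    rw [← NNReal.coe_pos]; exact sq_pos_of_pos hσ
  obtain ⟨C, r, hC, hr, H⟩ := exists_tall_lower_bound hc
  refine ⟨C, r, hC, hr, fun n p D lam hD k hk => ?_⟩
  have := hD.isProbabilityMeasure_sampleLaw n
  have hcard : Fintype.card {i : Fin p // i < k} = (k : ℕ) := by
    rw [Fintype.card_subtype]
    have : (Finset.univ.filter fun i : Fin p => i < k) = Finset.Iio k := by ext; simp
    rw [this, Fin.card_Iio]
  have h1 := H _ {i : Fin p // i < k} (Fin n) _ _ (fun _ => 1)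
    ((hD.isSubgaussianArray n).swap.comp_left (f := fun i : {i : Fin p // i < k} => (i : Fin p))
      Subtype.val_injective) (fun _ => zero_le_one) (fun _ => le_rfl)
    (by rw [hcard]; simpa using hk)
  simp only [Finset.sum_const, Finset.card_univ, Fintype.card_fin, nsmul_eq_mul, mul_one] at h1
  refine (measureReal_mono (fun X hX => ?_) (measure_ne_top _ _)).trans h1
  intro hcon
  refine hX fun u => ?_
  have h2 := hcon (WithLp.toLp 2 u)
  have h3 := pow_le_pow_left₀ (by positivity) h2 2
  rw [norm_arrayMap_sq _ (fun _ => zero_le_one), mul_pow, div_pow, Real.sq_sqrt (by positivity),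
    EuclideanSpace.real_norm_sq_eq, quadForm] at h3
  simp only [one_mul] at h3
  refine le_trans (le_of_eq ?_) h3
  norm_num

theorem sampleLaw_column_le (hD : IsSourceLaw D lam σ) (hσ : 0 < σ) (j : Fin p) :
    (sampleLaw n D).real {X | ¬ ∑ r, X r j ^ 2 ≤ 8 * σ ^ 2 * n * lam j} ≤ Real.exp (-n) := by
  have := hD.isProbabilityMeasure_sampleLaw n
  have hc : 0 < sqParam σ := by
    rw [← NNReal.coe_pos]; exact sq_pos_of_pos hσ
  -- The direction e_j isolates column j, and K = 2 gives the constant 4σ²K = 8σ² with failure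
  -- probability e^(−n).
  have h1 := (hD.isSubgaussianArray n).swap.measureReal_le_quadForm hc (w := fun _ => 1)
    (a := EuclideanSpace.single j (1 : ℝ)) (by simp) (fun _ => zero_le_one) (fun _ => le_rfl) 2
  simp only [Finset.sum_const, Finset.card_univ, Fintype.card_fin, nsmul_eq_mul, mul_one] at h1
  refine (measureReal_mono (fun X hX => ?_) (measure_ne_top _ _)).trans
    (h1.trans (le_of_eq (by norm_num)))
  have h2 : quadForm (fun i r => whitened lam r i) (fun _ : Fin n => (1 : ℝ))
      (EuclideanSpace.single j (1 : ℝ)) X = (∑ r, X r j ^ 2) / lam j := by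
    rw [quadForm, Finset.sum_div]
    refine Finset.sum_congr rfl fun r _ => ?_
    rw [one_mul, colSum, Finset.sum_eq_single j (fun l _ hl => by simp [hl])
      (fun h => absurd (Finset.mem_univ j) h)]
    simp only [whitened, PiLp.single_apply, if_true, one_mul]
    rw [div_pow, Real.sq_sqrt (hD.pos j).le]
  have e1 : ((sqParam σ : NNReal) : ℝ) = σ ^ 2 := rfl
  simp only [Set.mem_ofPred_eq, not_le] at hX ⊢
  rw [h2, le_div_iff₀ (hD.pos j), e1]
  linarith

end Law

/-! ### Probability bookkeeping -/

/-- Only monotonicity and subadditivity are used, so neither event has to be measurable. -/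
theorem one_sub_le_measureReal {Ω : Type*} [MeasurableSpace Ω] {μ : Measure Ω}
    [IsProbabilityMeasure μ] {E B : Set Ω} {q : ℝ} (h : Bᶜ ⊆ E) (hB : μ.real B ≤ q) :
    1 - q ≤ μ.real E := by
  have h1 : (Set.univ : Set Ω) ⊆ E ∪ B := fun x _ => by
    by_cases hx : x ∈ B
    · exact Or.inr hx
    · exact Or.inl (h hx)
  have h2 := (measureReal_mono h1 (measure_ne_top μ _)).trans (measureReal_union_le E B)
  rw [probReal_univ] at h2
  linarith

/-- If the events `E j` have probability at most `δ`, then the total weight of those that occur is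
at most half of the total weight with probability at least `1 - 2 δ`. -/
theorem measureReal_half_weight_le {Ω ι : Type*} [MeasurableSpace Ω] [Fintype ι] {μ : Measure Ω}
    [IsProbabilityMeasure μ] (E : ι → Set Ω) {t : ι → ℝ} (ht : ∀ j, 0 ≤ t j) {δ : ℝ}
    (hδ : 0 ≤ δ) (hE : ∀ j, μ.real (E j) ≤ δ) :
    μ.real {ω | (∑ j, t j) / 2 < ∑ j, t j * (E j).indicator 1 ω} ≤ 2 * δ := by
  set s := ∑ j, t j with hs
  have hs0 : 0 ≤ s := Finset.sum_nonneg fun j _ => ht j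
  -- Measurable hulls have the same measure and larger indicators, so Markov's inequality applies
  -- even if the events are not measurable.
  set f : Ω → ℝ := fun ω => ∑ j, t j * (toMeasurable μ (E j)).indicator 1 ω with hf
  have hind : ∀ j, Integrable (fun ω => t j * (toMeasurable μ (E j)).indicator (1 : Ω → ℝ) ω) μ :=
    fun j => ((integrable_const (1 : ℝ)).indicator (measurableSet_toMeasurable _ _)).const_mul _
  have hle : ∀ ω, ∑ j, t j * (E j).indicator 1 ω ≤ f ω := fun ω =>
    Finset.sum_le_sum fun j _ => mul_le_mul_of_nonneg_left
      (Set.indicator_le_indicator_of_subset (subset_toMeasurable _ _) (fun _ => zero_le_one) ω)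
      (ht j)
  have hf0 : ∀ ω, 0 ≤ f ω := fun ω => Finset.sum_nonneg fun j _ =>
    mul_nonneg (ht j) (Set.indicator_nonneg (fun _ _ => zero_le_one) ω)
  have hfint : ∫ ω, f ω ∂μ ≤ s * δ := by
    rw [hf, integral_finsetSum _ fun j _ => hind j, hs, Finset.sum_mul]
    refine Finset.sum_le_sum fun j _ => ?_
    rw [integral_const_mul, integral_indicator_one (measurableSet_toMeasurable _ _), measureReal_def,
      measure_toMeasurable, ← measureReal_def]
    exact mul_le_mul_of_nonneg_left (hE j) (ht j)
  rcases hs0.eq_or_lt with h0 | h0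
  · have ht0 : ∀ j, t j = 0 := fun j =>
      (Finset.sum_eq_zero_iff_of_nonneg fun j _ => ht j).1 h0.symm j (Finset.mem_univ j)
    have hempty : {ω | s / 2 < ∑ j, t j * (E j).indicator (1 : Ω → ℝ) ω} = ∅ := by
      ext ω
      simp [ht0, ← h0]
    rw [hempty, measureReal_empty]
    positivity
  · have h1 := mul_meas_ge_le_integral_of_nonneg (ae_of_all μ hf0)
      (integrable_finsetSum _ fun j _ => hind j) (s / 2)
    have h2 : μ.real {ω | s / 2 < ∑ j, t j * (E j).indicator 1 ω} ≤ μ.real {ω | s / 2 ≤ f ω} :=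
      measureReal_mono (fun ω hω => (le_of_lt hω).trans (hle ω)) (measure_ne_top _ _)
    have h3 : s / 2 * μ.real {ω | s / 2 < ∑ j, t j * (E j).indicator 1 ω} ≤ s / 2 * (2 * δ) := by
      calc _ ≤ s / 2 * μ.real {ω | s / 2 ≤ f ω} := by gcongr
        _ ≤ ∫ ω, f ω ∂μ := h1
        _ ≤ _ := hfint.trans (le_of_eq (by ring))
    exact le_of_mul_le_mul_left h3 (by positivity)

/-- Absorbing constants and an initial range into the exponential rate. -/
theorem exists_rate {r : ℝ} (hr : 0 < r) {A N : ℝ} (hA : 0 ≤ A) (hN : 0 ≤ N) :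
    ∃ c₀ : ℝ, 1 ≤ c₀ ∧ ∀ c, c₀ ≤ c → ∀ x P : ℝ, 0 ≤ P → (N ≤ x → 1 - A * Real.exp (-r * x) ≤ P) →
      1 - 5 * Real.exp (-x / c) ≤ P := by
  refine ⟨N + 2 / r + 2 * A / r + 1, by
    have : 0 ≤ N + 2 / r + 2 * A / r := by positivity
    linarith, fun c hc x P hP h => ?_⟩
  have g1 : 0 ≤ 2 / r := by positivity
  have g2 : 0 ≤ 2 * A / r := by positivity
  have hc0 : 0 < c := by linarith
  -- For x ≤ c the claim is trivial because 5e^(−1) ≥ 1; this fixes the factor 5. For larger x, half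
  -- of the rate r absorbs `A` and the other half dominates 1/c.
  rcases le_total x c with hx | hx
  · have h1 : -1 ≤ -x / c := by rw [le_div_iff₀ hc0]; linarith
    have h2 : Real.exp (-1) ≤ Real.exp (-x / c) := Real.exp_le_exp.2 h1
    have h3 : 1 / 5 ≤ Real.exp (-1) := by
      rw [Real.exp_neg, ← one_div]
      exact one_div_le_one_div_of_le (Real.exp_pos 1) (by linarith [Real.exp_one_lt_d9])
    linarith
  · refine le_trans ?_ (h (by linarith))
    have hx0 : 0 < x := by linarith
    have h1 : Real.exp (-(r * x / 2)) ≤ Real.exp (-x / c) := by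
      rw [Real.exp_le_exp, neg_div, neg_le_neg_iff, div_le_iff₀ hc0]
      have h2 : 2 / r ≤ c := by linarith
      rw [div_le_iff₀ hr] at h2
      nlinarith
    have h2 : A * Real.exp (-r * x) ≤ Real.exp (-(r * x / 2)) := by
      have h3 : Real.exp (-r * x) = Real.exp (-(r * x / 2)) * Real.exp (-(r * x / 2)) := by
        rw [← Real.exp_add]; ring_nf
      have h4 : A * Real.exp (-(r * x / 2)) ≤ 1 := by
        rw [Real.exp_neg, ← div_eq_mul_inv, div_le_one (Real.exp_pos _)]
        have h5 : 2 * A / r ≤ x := by linarith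
        rw [div_le_iff₀ hr] at h5
        linarith [Real.add_one_le_exp (r * x / 2)]
      rw [h3, ← mul_assoc]
      exact mul_le_of_le_one_left (Real.exp_pos _).le h4
    have := Real.exp_pos (-x / c)
    linarith

/-! ### The bias on the event where all frame bounds hold -/

section Deterministic

variable {n p : ℕ} {lam : Fin p → ℝ} {k : Fin p} {X : Fin n → Fin p → ℝ}

theorem TailLower.isUnit_det {κ : ℝ} {T : Finset (Fin p)} (h : TailLower κ lam T X)
    (hpos : 0 < κ * ∑ i ∈ T, lam i) : IsUnit (Matrix.of X * (Matrix.of X)ᵀ).det := by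
  refine isUnit_det_of_injective fun v hv => ?_
  have h1 := h v
  simp only [hv, Pi.zero_apply, ne_eq, OfNat.ofNat_ne_zero, not_false_eq_true, zero_pow,
    Finset.sum_const_zero] at h1
  have h2 : ∑ r, v r ^ 2 ≤ 0 := nonpos_of_mul_nonpos_right h1 hpos
  have h3 := (Finset.sum_eq_zero_iff_of_nonneg fun r _ => sq_nonneg (v r)).1
    (h2.antisymm (Finset.sum_nonneg fun r _ => sq_nonneg (v r)))
  ext r
  exact pow_eq_zero_iff two_ne_zero |>.1 (h3 r (Finset.mem_univ r))

/-- The threshold λ_{k+1}ρ_k is S/n. For n = 0 both sides vanish by the convention on division by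
zero. -/
theorem lam_mul_effRatio (hk : lam k ≠ 0) :
    lam k * effRatio n lam k = (∑ i ∈ Finset.Ici k, lam i) / n := by
  unfold effRatio
  by_cases hn : (n : ℝ) = 0
  · simp [hn]
  · field_simp

/-- Let x = λ_i/(S/n). In the head, P_ii ≤ 1 and P_ii x ≤ 64K add up to P_ii(1 + x) ≤ 1 + 64K. In
the tail, x ≤ 1 because S ≥ nλ_{k+1}, so P_ii(1 + x) ≤ 2. -/
theorem bias_le_of_frame_bounds {lamT : Fin p → ℝ} (hT : ∀ i, 0 ≤ lamT i)
    (hlam : ∀ i, 0 < lam i) (hanti : Antitone lam) (hn : (0 : ℝ) < n) {K : ℝ} (hK : 0 ≤ K)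
    (hS : n * lam k ≤ ∑ i ∈ Finset.Ici k, lam i)
    (hX : IsUnit (Matrix.of X * (Matrix.of X)ᵀ).det) (htail : TailUpper K lam (Finset.Ici k) X)
    (hhead : HeadLower lam k X) (θ : Fin p → ℝ) :
    bias lamT (Matrix.of X) θ ≤ (2 + 64 * K) * ((∑ i, θ i ^ 2) *
      ∑ i, lamT i / (1 + lam i / (lam k * effRatio n lam k))) := by
  set S := ∑ i ∈ Finset.Ici k, lam i with hSdef
  have hk := hlam k
  have hS0 : 0 < S := lt_of_lt_of_le (by positivity) hS
  rw [lam_mul_effRatio hk.ne', ← hSdef]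
  refine (bias_le hT hX θ).trans ?_
  rw [mul_left_comm]
  refine mul_le_mul_of_nonneg_left ?_ (Finset.sum_nonneg fun i _ => sq_nonneg _)
  rw [Finset.mul_sum]
  refine Finset.sum_le_sum fun i _ => ?_
  have hi := hlam i
  have hx : 0 < lam i / (S / n) := by positivity
  have key : nullProj (Matrix.of X) i i ≤ (2 + 64 * K) / (1 + lam i / (S / n)) := by
    have h1 := nullProj_diag_le_one hX i
    rw [le_div_iff₀ (by positivity)]
    rcases lt_or_ge i k with hik | hik
    · have h2 := nullProj_diag_le_of_head hX lam hlam (fun i => i < k) (τ := n / 64)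
        (K := K * S) (by positivity) (by positivity) hhead
        (by
          intro a
          have : (Finset.univ.filter fun i => ¬ i < k) = Finset.Ici k := by ext; simp
          rw [this]
          exact htail a) i hik
      have h3 : K * S / (n / 64 * lam i) * (lam i / (S / n)) = 64 * K := by
        field_simp
      have h4 := mul_le_mul_of_nonneg_right h2 hx.le
      rw [h3] at h4
      linarith
    · have h2 : lam i / (S / n) ≤ 1 := by
        rw [div_le_one (by positivity), le_div_iff₀ hn]
        nlinarith [hanti hik]
      have h3 := mul_le_mul_of_nonneg_right h1 (by positivity : 0 ≤ 1 + lam i / (S / n))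
      linarith
  calc _ ≤ lamT i * ((2 + 64 * K) / (1 + lam i / (S / n))) :=
        mul_le_mul_of_nonneg_left key (hT i)
    _ = _ := by ring

/-- The weight of the `j`-th coordinate in the lower bound for the bias. -/
noncomputable def biasWeight (n : ℕ) (lam : Fin p → ℝ) (k j : Fin p) : ℝ :=
  if j < k then 1 / (1 + lam j / (lam k * effRatio n lam k)) ^ 2 else 1

theorem biasWeight_nonneg (n : ℕ) (lam : Fin p → ℝ) (k j : Fin p) :
    0 ≤ biasWeight n lam k j := by
  unfold biasWeight
  split_ifs <;> positivity

theorem sum_mul_biasWeight (n : ℕ) (lam : Fin p → ℝ) (k : Fin p) (t : Fin p → ℝ) :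
    ∑ j, t j * biasWeight n lam k j =
      (∑ i ∈ Finset.Iio k, t i / (1 + lam i / (lam k * effRatio n lam k)) ^ 2) +
        ∑ i ∈ Finset.Ici k, t i := by
  have h1 : (Finset.univ.filter fun i => i < k) = Finset.Iio k := by ext; simp
  have h2 : (Finset.univ.filter fun i => ¬ i < k) = Finset.Ici k := by ext; simp
  rw [← Finset.sum_filter_add_sum_filter_not Finset.univ (fun i => i < k), h1, h2]
  congr 1
  · refine Finset.sum_congr rfl fun i hi => ?_
    rw [biasWeight, if_pos (Finset.mem_Iio.1 hi), mul_one_div]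
  · refine Finset.sum_congr rfl fun i hi => ?_
    rw [biasWeight, if_neg (not_lt.2 (Finset.mem_Ici.1 hi)), mul_one]

/-- A removed eigenvalue is at most λ_{k+1}, hence at most a third of the tail sum when ρ_k ≥ 3.
What is left is at least 2nλ_{k+1}, the aspect ratio required for the lower frame bound. -/
theorem two_thirds_le_sum_erase (hlam : ∀ i, 0 < lam i) (hanti : Antitone lam)
    (hn : (1 : ℝ) ≤ n) (hS : 3 * (n * lam k) ≤ ∑ i ∈ Finset.Ici k, lam i) (j : Fin p) :
    2 / 3 * ∑ i ∈ Finset.Ici k, lam i ≤ ∑ i ∈ (Finset.Ici k).erase j, lam i := by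
  have hk := hlam k
  by_cases hj : j ∈ Finset.Ici k
  · have h1 := Finset.sum_erase_add _ lam hj
    have h2 := hanti (Finset.mem_Ici.1 hj)
    nlinarith
  · rw [Finset.erase_eq_of_notMem hj]
    have : 0 ≤ ∑ i ∈ Finset.Ici k, lam i := Finset.sum_nonneg fun i _ => (hlam i).le
    linarith

/-- With A of order nλ_j and B of order S, the ratio A/B is a constant times λ_j/(λ_{k+1}ρ_k). The
factor 4 serves the tail coordinates, where that quotient is at most 1 and the weight is replaced by
1. -/
theorem biasWeight_le_nullProj_diag_sq (hlam : ∀ i, 0 < lam i) (hanti : Antitone lam)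
    (hn : (1 : ℝ) ≤ n) (hS : 3 * (n * lam k) ≤ ∑ i ∈ Finset.Ici k, lam i) {κ A D : ℝ} (hκ : 0 < κ)
    (hA : 0 < A) (hD : 3 * A / (2 * κ) ≤ D) (hD1 : 1 ≤ D)
    (hX : IsUnit (Matrix.of X * (Matrix.of X)ᵀ).det) (j : Fin p)
    (htail : TailLower κ lam ((Finset.Ici k).erase j) X)
    (hcol : ∑ r, X r j ^ 2 ≤ A * n * lam j) :
    biasWeight n lam k j / (4 * D ^ 2) ≤ nullProj (Matrix.of X) j j ^ 2 := by
  have hT := two_thirds_le_sum_erase hlam hanti hn hS j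
  set S := ∑ i ∈ Finset.Ici k, lam i with hSdef
  have hk := hlam k
  have hj := hlam j
  have hn0 : (0 : ℝ) < n := by linarith
  have hS0 : 0 < S := lt_of_lt_of_le (by positivity) hS
  have hm := lam_mul_effRatio (n := n) (k := k) hk.ne'
  rw [← hSdef] at hm
  have hx : 0 < lam j / (S / n) := by positivity
  have h1 := le_nullProj_diag hX j ((Finset.Ici k).erase j) (Finset.notMem_erase j _)
    (A := A * n * lam j) (B := κ * (2 / 3 * S)) (by positivity) (by positivity)
    (fun a => le_trans (by gcongr) (htail a)) hcol
  have h2 : A * n * lam j / (κ * (2 / 3 * S)) = 3 * A / (2 * κ) * (lam j / (S / n)) := by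
    field_simp
  rw [h2] at h1
  have h3 : 1 / (D * (1 + lam j / (S / n))) ≤ nullProj (Matrix.of X) j j := by
    refine le_trans (one_div_le_one_div_of_le (by positivity) ?_) h1
    have := mul_le_mul_of_nonneg_right hD hx.le
    linarith
  have h4 := pow_le_pow_left₀ (by positivity) h3 2
  refine le_trans ?_ h4
  rw [div_pow, one_pow, mul_pow]
  unfold biasWeight
  rw [hm]
  split_ifs with hjk
  · rw [div_div]
    refine one_div_le_one_div_of_le (by positivity) ?_
    have : 0 ≤ D ^ 2 * (1 + lam j / (S / n)) ^ 2 := by positivity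
    linarith
  · have h5 : lam j / (S / n) ≤ 1 := by
      rw [div_le_one (by positivity), le_div_iff₀ hn0]
      nlinarith [hanti (not_lt.1 hjk)]
    refine one_div_le_one_div_of_le (by positivity) ?_
    have h6 : (1 + lam j / (S / n)) ^ 2 ≤ 4 := by nlinarith
    nlinarith [sq_nonneg D]

/-- If the coordinates whose diagonal entry is not bounded below have at most half of the total
weight, then the expected bias is of the order of the total weight. -/
theorem le_expectedBias_of_half_weight {lamT : Fin p → ℝ} (hT : ∀ i, 0 ≤ lamT i) (θ : Fin p → ℝ)
    {D : ℝ} (hD : 1 ≤ D) (E : Fin p → Set (Fin n → Fin p → ℝ))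
    (hE : ∀ j, X ∉ E j → biasWeight n lam k j / (4 * D ^ 2) ≤ nullProj (Matrix.of X) j j ^ 2)
    (hhalf : ∑ j, lamT j * θ j ^ 2 * biasWeight n lam k j * (E j).indicator 1 X ≤
      (∑ j, lamT j * θ j ^ 2 * biasWeight n lam k j) / 2) :
    (∑ j, lamT j * θ j ^ 2 * biasWeight n lam k j) / (8 * D ^ 2) ≤
      expectedBias lamT (Matrix.of X) θ := by
  refine le_trans ?_ (le_expectedBias hT _ θ)
  set t := fun j => lamT j * θ j ^ 2 * biasWeight n lam k j with ht
  have h1 : ∀ j, (t j - t j * (E j).indicator 1 X) / (4 * D ^ 2) ≤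
      lamT j * θ j ^ 2 * nullProj (Matrix.of X) j j ^ 2 := fun j => by
    have h0 := mul_nonneg (hT j) (sq_nonneg (θ j))
    by_cases hj : X ∈ E j
    · rw [Set.indicator_of_mem hj, Pi.one_apply, mul_one, sub_self, zero_div]
      positivity
    · rw [Set.indicator_of_notMem hj, mul_zero, sub_zero, ht]
      have := mul_le_mul_of_nonneg_left (hE j hj) h0
      rwa [← mul_div_assoc] at this
  refine le_trans ?_ (Finset.sum_le_sum fun j _ => h1 j)
  rw [← Finset.sum_div, Finset.sum_sub_distrib]
  have h2 : (∑ j, t j) / (8 * D ^ 2) = (∑ j, t j) / 2 / (4 * D ^ 2) := by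
    rw [div_div]; ring_nf
  rw [h2]
  gcongr
  linarith

end Deterministic

/-! ### The main theorem -/

theorem exp_neg_mul_le {ρ r x : ℝ} (h : ρ ≤ r) (hx : 0 ≤ x) :
    Real.exp (-r * x) ≤ Real.exp (-ρ * x) :=
  Real.exp_le_exp.2 (mul_le_mul_of_nonneg_right (neg_le_neg h) hx)

theorem measureReal_union_le_add {Ω : Type*} [MeasurableSpace Ω] {μ : Measure Ω} {A B : Set Ω}
    {a b : ℝ} (hA : μ.real A ≤ a) (hB : μ.real B ≤ b) : μ.real (A ∪ B) ≤ a + b :=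
  (measureReal_union_le A B).trans (add_le_add hA hB)

theorem theorem3p3 :
    ∃ b : ℝ, 1 < b ∧ ∀ σ : ℝ, 0 < σ → ∃ c C : ℝ, 1 < c ∧ 1 < C ∧
      ∀ (n p : ℕ), n < p →
      ∀ (D : Measure (Fin p → ℝ)) (lam lamT : Fin p → ℝ), IsSourceLaw D lam σ →
      (∀ i, 0 ≤ lamT i) →
      ∀ (θ : Fin p → ℝ) (k : Fin p), ((k : ℕ) : ℝ) < n / C → b ≤ effRatio n lam k →
        (1 - 10 * Real.exp (-n / c) ≤
          (sampleLaw n D).real {X : Fin n → Fin p → ℝ |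
            IsUnit (Matrix.of X * (Matrix.of X)ᵀ).det ∧
            1 / c *
              ((∑ i ∈ Finset.Iio k,
                  lamT i * θ i ^ 2 / (1 + lam i / (lam k * effRatio n lam k)) ^ 2) +
                ∑ i ∈ Finset.Ici k, lamT i * θ i ^ 2)
              ≤ expectedBias lamT (Matrix.of X) θ}) ∧
        (∀ a : ℝ, 0 < a → (p : ℝ) ≤ Real.exp (a * n) →
          1 - 5 * Real.exp (-n / c) ≤
            (sampleLaw n D).real {X : Fin n → Fin p → ℝ |
              IsUnit (Matrix.of X * (Matrix.of X)ᵀ).det ∧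
              bias lamT (Matrix.of X) θ ≤
                c * ((∑ i, θ i ^ 2) *
                  ∑ i, lamT i / (1 + lam i / (lam k * effRatio n lam k)))}) := by
  -- The value 3 leaves aspect ratio 2 after removal of one column, and this ratio suffices for
  -- every σ.
  refine ⟨3, by norm_num, fun σ hσ => ?_⟩
  obtain ⟨κ, r, N, hκ, hr, hN, hlower⟩ := exists_sampleLaw_not_tailLower_le hσ
  obtain ⟨Ct, rh, hCt, hrh, hheadp⟩ := exists_sampleLaw_not_headLower_le hσ
  set ρ := min (min r rh) 1 with hρ
  have hρ0 : 0 < ρ := lt_min (lt_min hr hrh) one_pos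
  have hρr : ρ ≤ r := (min_le_left _ _).trans (min_le_left _ _)
  have hρh : ρ ≤ rh := (min_le_left _ _).trans (min_le_right _ _)
  have hρ1 : ρ ≤ 1 := min_le_right _ _
  -- The factor 11 is 3 for the full tail plus 2·4 from the half-weight argument; the upper bound
  -- needs only 3 + 1 + 2.
  obtain ⟨c₀, hc₀, hrate⟩ := exists_rate hρ0 (A := 11) (N := N) (by norm_num) hN.le
  set K := 80 * σ ^ 2 with hK
  have hK0 : 0 ≤ K := by positivity
  set Δ := 1 + 3 * (8 * σ ^ 2) / (2 * κ) with hΔ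
  have hΔ1 : 1 ≤ Δ := le_add_of_nonneg_right (by positivity)
  refine ⟨c₀ + (2 + 64 * K) + 8 * Δ ^ 2, Ct + 1, by nlinarith, by linarith, ?_⟩
  set c := c₀ + (2 + 64 * K) + 8 * Δ ^ 2 with hc
  have hcc₀ : c₀ ≤ c := by nlinarith
  have hcK : 2 + 64 * K ≤ c := by nlinarith
  have hcΔ : 8 * Δ ^ 2 ≤ c := by linarith
  intro n p _ D lam lamT hD hT θ k hkn hb
  have := hD.isProbabilityMeasure_sampleLaw n
  have hn0 : (0 : ℝ) < n := by
    by_contra hcon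
    have h1 : (n : ℝ) / (Ct + 1) ≤ 0 :=
      div_nonpos_of_nonpos_of_nonneg (not_lt.1 hcon) (by linarith)
    linarith [(Nat.cast_nonneg (k : ℕ) : (0 : ℝ) ≤ _)]
  have hn1 : (1 : ℝ) ≤ n := by exact_mod_cast Nat.one_le_iff_ne_zero.2 (by rintro rfl; simp at hn0)
  have hk := hD.pos k
  have hkC : Ct * (k : ℕ) ≤ n := by
    rw [lt_div_iff₀ (by linarith)] at hkn
    nlinarith [(Nat.cast_nonneg (k : ℕ) : (0 : ℝ) ≤ _)]
  have hS : 3 * (n * lam k) ≤ ∑ i ∈ Finset.Ici k, lam i := by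
    rwa [effRatio, le_div_iff₀ (by positivity)] at hb
  have hnk : 0 < n * lam k := by positivity
  set S := ∑ i ∈ Finset.Ici k, lam i with hSdef
  have hle : ∀ i ∈ Finset.Ici k, lam i ≤ lam k := fun i hi => hD.antitone (Finset.mem_Ici.1 hi)
  have hexp := Real.exp_pos (-ρ * n)
  have hexp1 : Real.exp (-n : ℝ) ≤ Real.exp (-ρ * n) := by
    simpa using exp_neg_mul_le hρ1 hn0.le
  have hlowerT : ∀ T ⊆ Finset.Ici k, 2 * (n * lam k) ≤ ∑ i ∈ T, lam i → N ≤ n →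
      (sampleLaw n D).real {X | ¬ TailLower κ lam T X} ≤ 3 * Real.exp (-ρ * n) :=
    fun T hTs hTsum hNn => (hlower n p D lam hD hNn T (lam k) hk (fun i hi => hle i (hTs hi))
      hTsum).trans (mul_le_mul_of_nonneg_left (exp_neg_mul_le hρr hn0.le) (by norm_num))
  have hunit : ∀ X : Fin n → Fin p → ℝ, TailLower κ lam (Finset.Ici k) X →
      IsUnit (Matrix.of X * (Matrix.of X)ᵀ).det := fun X hX =>
    hX.isUnit_det (mul_pos hκ (by linarith))
  constructor
  · set A := 8 * σ ^ 2 with hA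
    -- Coordinate j is bad if the tail without column j loses its frame bound or column j is too
    -- long.
    set E : Fin p → Set (Fin n → Fin p → ℝ) := fun j =>
      {X | ¬ TailLower κ lam ((Finset.Ici k).erase j) X} ∪ {X | ¬ ∑ r, X r j ^ 2 ≤ A * n * lam j}
      with hEdef
    set t : Fin p → ℝ := fun j => lamT j * θ j ^ 2 * biasWeight n lam k j with ht
    have ht0 : ∀ j, 0 ≤ t j := fun j =>
      mul_nonneg (mul_nonneg (hT j) (sq_nonneg _)) (biasWeight_nonneg _ _ _ _)
    refine le_trans (by linarith [Real.exp_pos (-n / c)]) (hrate c hcc₀ n _ measureReal_nonneg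
      fun hNn => ?_)
    have hE : ∀ j, (sampleLaw n D).real (E j) ≤ 4 * Real.exp (-ρ * n) := fun j => by
      have h1 := two_thirds_le_sum_erase hD.pos hD.antitone hn1 hS j
      refine (measureReal_union_le_add (hlowerT _ (Finset.erase_subset _ _) (by linarith) hNn)
        (sampleLaw_column_le hD hσ j)).trans (by linarith)
    -- Markov's inequality replaces a union over j, so p does not enter the probability.
    have hhalf := measureReal_half_weight_le E ht0 (by positivity) hE
    refine one_sub_le_measureReal (fun X hX => ?_) ((measureReal_union_le_add
      (hlowerT _ subset_rfl (by linarith) hNn) hhalf).trans (by linarith))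
    simp only [Set.mem_compl_iff, Set.mem_union, Set.mem_ofPred_eq, not_or, not_not, not_lt] at hX
    have hU := hunit X hX.1
    refine ⟨hU, ?_⟩
    rw [← sum_mul_biasWeight n lam k fun j => lamT j * θ j ^ 2]
    have h1 := le_expectedBias_of_half_weight hT θ hΔ1 E (fun j hj => by
      simp only [hEdef, Set.mem_union, Set.mem_ofPred_eq, not_or, not_not] at hj
      exact biasWeight_le_nullProj_diag_sq hD.pos hD.antitone hn1 hS hκ (by positivity)
        (by linarith) hΔ1 hU j hj.1 hj.2) hX.2
    refine le_trans ?_ h1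
    rw [one_div_mul_eq_div]
    exact div_le_div_of_nonneg_left (Finset.sum_nonneg fun j _ => ht0 j) (by positivity) hcΔ
  · intro _ _ _
    refine hrate c hcc₀ n _ measureReal_nonneg fun hNn => ?_
    have hhead := (hheadp n p D lam hD k hkC).trans
      (mul_le_mul_of_nonneg_left (exp_neg_mul_le hρh hn0.le) zero_le_two)
    have htail := sampleLaw_not_tailUpper_le (n := n) hD hσ hk hle (by linarith)
    refine one_sub_le_measureReal (fun X hX => ?_) ((measureReal_union_le_add
      (measureReal_union_le_add (hlowerT _ subset_rfl (by linarith) hNn) htail) hhead).trans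
        (by linarith))
    simp only [Set.mem_compl_iff, Set.mem_union, Set.mem_ofPred_eq, not_or, not_not] at hX
    have hU := hunit X hX.1.1
    refine ⟨hU, (bias_le_of_frame_bounds hT hD.pos hD.antitone hn0 hK0 (by linarith) hU hX.1.2
      hX.2 θ).trans (mul_le_mul_of_nonneg_right hcK ?_)⟩
    have hR : 0 ≤ lam k * effRatio n lam k := by
      rw [lam_mul_effRatio hk.ne']
      exact div_nonneg (by linarith) hn0.le
    refine mul_nonneg (Finset.sum_nonneg fun i _ => sq_nonneg _)
      (Finset.sum_nonneg fun i _ => div_nonneg (hT i) ?_)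
    have := div_nonneg (hD.pos i).le hR
    linarith
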